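/- Let $1\le k\le n$ be integers, let $R$ be a commutative ring, and let $\mathcal S=R[x_1,\dots,x_k]^{\mathfrak S_k}$ be the ring of symmetric polynomials in $k$ variables over $R$. Let $a_1,\dots,a_k\in\mathcal S$ satisfy $\deg(a_i)<n-k+i$ for $i=1,\dots,k$ (total degree as a polynomial in $x_1,\dots,x_k$), and consider the ideals $$\mathcal J=\langle p_{n-k+1}-a_1,\dots,p_n-a_k\rangle,\qquad \mathcal I=\langle h_{n-k+1}-a_1,\dots,h_n-a_k\rangle$$ of $\mathcal S$, where $p_i=\sum_j x_j^i$ is the power sum and $h_i=\sum_{j_1\le\dots\le j_i}x_{j_1}\cdots x_{j_i}$ the complete homogeneous symmetric polynomial. Let $P_{k,n-k}$ be the set of partitions $\lambda=(\lambda_1\ge\lambda_2\ge\cdots)$ with at most $k$ parts, each at most $n-k$, and let $\lambda'$ denote the conjugate of $\lambda$. Consider the Schur polynomials $s_\lambda=\det(x_j^{\lambda_i+k-i})_{i,j=1}^k/\det(x_j^{k-i})_{i,j=1}^k$, the monomial symmetric polynomials $m_\lambda$ (the sum of the monomials $x_1^{b_1}\cdots x_k^{b_k}$ over the distinct permutations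 $(b_1,\dots,b_k)$ of $(\lambda_1,\dots,\lambda_k)$), and the elementary symmetric polynomials $e_\mu=\prod_i e_{\mu_i}$, where $e_i=\sum_{j_1<\dots<j_i}x_{j_1}\cdots x_{j_i}$. (1) If $R$ is moreover a $\mathbb Q$-algebra, then the residue classes of each of the three families $(s_\lambda)_{\lambda\in P_{k,n-k}}$, $(m_\lambda)_{\lambda\in P_{k,n-k}}$ and $(e_{\lambda'})_{\lambda\in P_{k,n-k}}$ form a basis of the $R$-module $\mathcal S/\mathcal J$. (2) For every commutative ring $R$, the residue classes of each of these three families form a basis of the $R$-module $\mathcal S/\mathcal I$. -/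

import Mathlib

open MvPolynomial

noncomputable section

namespace SymBases

/-- The ring `𝓢` of symmetric polynomials in `x_1, …, x_k` over `R`. -/
abbrev SymRing (k : ℕ) (R : Type*) [CommRing R] : Type _ :=
  symmetricSubalgebra (Fin k) R

/-- The partitions with at most `k` parts, each at most `m`.  A partition is a Young diagram `μ`:
its parts (weakly decreasing, numbered from `0`) are `μ.rowLen 0, μ.rowLen 1, …`, its number of
parts is `μ.colLen 0`, and its conjugate is `μ.transpose`. -/
abbrev Box (k m : ℕ) : Type :=
  {μ : YoungDiagram // μ.colLen 0 ≤ k ∧ μ.rowLen 0 ≤ m}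

/-- The multiset of (positive) parts of a partition, as a `Nat.Partition`. -/
def parts (μ : YoungDiagram) : Nat.Partition (μ.rowLens : Multiset ℕ).sum :=
  Nat.Partition.ofMultiset (μ.rowLens : Multiset ℕ)

/-! ### Schur polynomials as quotients of alternants -/

/-- The alternant `det (x_j ^ (e_i))_{i,j}`. -/
def alternant {k : ℕ} (R : Type*) [CommRing R] (e : Fin k → ℕ) : MvPolynomial (Fin k) R :=
  Matrix.det (Matrix.of fun i j : Fin k => (X j : MvPolynomial (Fin k) R) ^ e i)

/-- The exponents `k - 1, k - 2, …, 0`. -/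
def stair (k : ℕ) (i : Fin k) : ℕ := k - 1 - i

/-- Any alternant is a multiple of the Vandermonde determinant. -/
theorem vandermonde_dvd {A : Type*} [CommRing A] {k : ℕ} (v : Fin k → A) (e : Fin k → ℕ) :
    (Matrix.vandermonde v).det ∣ Matrix.det (Matrix.of fun i j : Fin k => v j ^ e i) := by
  rcases subsingleton_or_nontrivial A with h | h
  · exact ⟨0, Subsingleton.elim _ _⟩
  let P : Polynomial A := ∏ j, (Polynomial.X - Polynomial.C (v j))
  have hP : P.Monic := Polynomial.monic_prod_of_monic _ _ fun j _ => Polynomial.monic_X_sub_C _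
  have hdeg : P.degree = k := by
    rw [Polynomial.degree_eq_natDegree hP.ne_zero]
    simp [P, Polynomial.natDegree_prod_of_monic _ _ fun j _ => Polynomial.monic_X_sub_C (v j)]
  let r : Fin k → Polynomial A := fun i => (Polynomial.X ^ e i : Polynomial A) %ₘ P
  have hr : ∀ i j, v j ^ e i = ∑ l : Fin k, (r i).coeff l * v j ^ (l : ℕ) := by
    intro i j
    have hroot : P.eval (v j) = 0 := by
      simp only [P, Polynomial.eval_prod]
      exact Finset.prod_eq_zero (Finset.mem_univ j) (by simp)
    have h1 : (r i).eval (v j) = v j ^ e i := by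
      have := congrArg (Polynomial.eval (v j))
        (Polynomial.modByMonic_add_div (Polynomial.X ^ e i : Polynomial A) P)
      simpa [hroot] using this
    have hlt : (r i).degree < k := hdeg ▸ Polynomial.degree_modByMonic_lt _ hP
    rw [← h1, Polynomial.eval_eq_sum_degreeLTEquiv (n := k)
      (Polynomial.mem_degreeLT.2 hlt)]
    rfl
  have hM : (Matrix.of fun i j : Fin k => v j ^ e i) =
      (Matrix.of fun i l : Fin k => (r i).coeff l) * (Matrix.vandermonde v).transpose := by
    ext i j
    simp [Matrix.mul_apply, hr i j, Matrix.vandermonde_apply]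
  rw [hM, Matrix.det_mul, Matrix.det_transpose]
  exact Dvd.intro_left _ rfl

theorem vandermonde_mem_nonZeroDivisors (k : ℕ) (R : Type*) [CommRing R] :
    (Matrix.vandermonde (X : Fin k → MvPolynomial (Fin k) R)).det ∈
      nonZeroDivisors (MvPolynomial (Fin k) R) := by
  rw [Matrix.det_vandermonde]
  refine prod_mem_nonZeroDivisors_of_mem_nonZeroDivisors fun i _ =>
    prod_mem_nonZeroDivisors_of_mem_nonZeroDivisors fun j hj => ?_
  have hij : i ≠ j := (Finset.mem_Ioi.1 hj).ne
  rw [mem_nonZeroDivisors_iff_right]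
  intro f hf
  -- the substitutions `x_j ↦ x_j + x_i` and `x_j ↦ x_j - x_i` are inverse to each other
  let φ : MvPolynomial (Fin k) R →ₐ[R] MvPolynomial (Fin k) R :=
    aeval fun l => if l = j then X j + X i else X l
  let ψ : MvPolynomial (Fin k) R →ₐ[R] MvPolynomial (Fin k) R :=
    aeval fun l => if l = j then X j - X i else X l
  have hψφ : ψ.comp φ = AlgHom.id R _ := by
    ext1 l
    by_cases hl : l = j
    · subst hl; simp [φ, ψ, hij]
    · simp [φ, ψ, hl]
  have h1 : φ f * X j = 0 := by
    have := congrArg φ hf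
    simpa [φ, hij] using this
  have h2 : φ f = 0 := by
    ext d
    have := congrArg (coeff (d + Finsupp.single j 1)) h1
    simpa [coeff_mul_X] using this
  have h3 := DFunLike.congr_fun hψφ f
  simpa [h2] using h3.symm

/-- The denominator is the Vandermonde determinant up to sign. -/
theorem alternant_stair (k : ℕ) (R : Type*) [CommRing R] :
    ∃ u : ℤˣ, alternant R (stair k) =
      u • (Matrix.vandermonde (X : Fin k → MvPolynomial (Fin k) R)).det := by
  refine ⟨Equiv.Perm.sign (Fin.revPerm : Equiv.Perm (Fin k)), ?_⟩
  rw [← Matrix.det_transpose (Matrix.vandermonde _), Units.smul_def, zsmul_eq_mul,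
    ← Matrix.det_permute]
  unfold alternant
  congr 1
  ext1 i j
  simp [stair, Matrix.vandermonde_apply, Fin.val_rev, Nat.sub_sub, Nat.add_comm]

theorem alternant_stair_mem_nonZeroDivisors (k : ℕ) (R : Type*) [CommRing R] :
    alternant R (stair k) ∈ nonZeroDivisors (MvPolynomial (Fin k) R) := by
  obtain ⟨u, hu⟩ := alternant_stair k R
  rw [hu]
  have h := vandermonde_mem_nonZeroDivisors k R
  rcases Int.units_eq_one_or u with rfl | rfl
  · simpa using h
  · simpa using mul_mem ((isUnit_one.neg : IsUnit (-1 : MvPolynomial (Fin k) R)).mem_nonZeroDivisors) h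

/-- The quotient of an alternant by `det (x_j ^ (k - i))` exists and is unique, over any
commutative ring. -/
theorem existsUnique_quotient {k : ℕ} (R : Type*) [CommRing R] (e : Fin k → ℕ) :
    ∃! s : MvPolynomial (Fin k) R, s * alternant R (stair k) = alternant R e := by
  obtain ⟨u, hu⟩ := alternant_stair k R
  have hd : alternant R (stair k) ∣ alternant R e := by
    have h := vandermonde_dvd (X : Fin k → MvPolynomial (Fin k) R) e
    rw [hu]
    rcases Int.units_eq_one_or u with rfl | rfl <;> simpa [alternant] using h
  obtain ⟨s, hs⟩ := hd
  refine ⟨s, by rw [hs, mul_comm], fun t ht => ?_⟩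
  refine (mul_cancel_right_mem_nonZeroDivisors (alternant_stair_mem_nonZeroDivisors k R)).1 ?_
  rw [ht, hs, mul_comm]

/-- The Schur polynomial `s_μ`: the quotient of `det (x_j ^ (μ_i + k - i))` by
`det (x_j ^ (k - i))` if `μ` has at most `k` parts, and `0` otherwise. -/
def schurQuotient (k : ℕ) (R : Type*) [CommRing R] (μ : YoungDiagram) : MvPolynomial (Fin k) R :=
  if μ.colLen 0 ≤ k then
    (existsUnique_quotient R fun i : Fin k => μ.rowLen i + stair k i).choose
  else 0

theorem schurQuotient_mul (k : ℕ) (R : Type*) [CommRing R] (μ : YoungDiagram) (h : μ.colLen 0 ≤ k) :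
    schurQuotient k R μ * alternant R (stair k) =
      alternant R (fun i : Fin k => μ.rowLen i + stair k i) := by
  rw [schurQuotient, if_pos h]
  exact (existsUnique_quotient R fun i : Fin k => μ.rowLen i + stair k i).choose_spec.1

theorem rename_alternant {k : ℕ} (R : Type*) [CommRing R] (e : Fin k → ℕ)
    (σ : Equiv.Perm (Fin k)) :
    rename σ (alternant R e) = Equiv.Perm.sign σ * alternant R e := by
  unfold alternant
  rw [← Matrix.det_permute', AlgHom.map_det]
  congr 1
  ext1 i j
  simp

theorem schurQuotient_isSymmetric (k : ℕ) (R : Type*) [CommRing R] (μ : YoungDiagram) :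
    (schurQuotient k R μ).IsSymmetric := by
  intro σ
  by_cases h : μ.colLen 0 ≤ k
  · have h0 := schurQuotient_mul k R μ h
    have h1 := congrArg (rename σ) h0
    rw [map_mul, rename_alternant, rename_alternant, ← h0] at h1
    refine (mul_cancel_right_mem_nonZeroDivisors (alternant_stair_mem_nonZeroDivisors k R)).1 ?_
    rcases Int.units_eq_one_or (Equiv.Perm.sign σ) with hs | hs <;> simpa [hs] using h1
  · simp [schurQuotient, h]

/-! ### The families, as elements of the ring of symmetric polynomials -/

variable (k : ℕ) (R : Type*) [CommRing R]

/-- The complete homogeneous symmetric polynomial `h_i`. -/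
def hPoly (i : ℕ) : SymRing k R := ⟨hsymm (Fin k) R i, hsymm_isSymmetric _ _ i⟩

/-- The power sum symmetric polynomial `p_i`, for `i ≥ 1`. -/
def pPoly (i : ℕ) : SymRing k R := ⟨psum (Fin k) R i, psum_isSymmetric _ _ i⟩

/-- The elementary symmetric polynomial `e_μ`, the product of the `e_i` over the parts `i`
of `μ`. -/
def ePoly (μ : YoungDiagram) : SymRing k R :=
  (μ.rowLens.map fun i => (⟨esymm (Fin k) R i, esymm_isSymmetric _ _ i⟩ : SymRing k R)).prod

/-- The monomial symmetric polynomial `m_μ`. -/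
def mPoly (μ : YoungDiagram) : SymRing k R :=
  ⟨msymm (Fin k) R (parts μ), msymm_isSymmetric _ _ _⟩

/-- The Schur polynomial `s_μ`. -/
def sPoly (μ : YoungDiagram) : SymRing k R :=
  ⟨schurQuotient k R μ, schurQuotient_isSymmetric k R μ⟩

variable {k R}

/-- The ideal `⟨h_{n-k+1} - a_1, …, h_n - a_k⟩`; here `a_i` is indexed by `i = 0, …, k - 1`. -/
def idealH (n : ℕ) (a : Fin k → SymRing k R) : Ideal (SymRing k R) :=
  Ideal.span (Set.range fun i : Fin k => hPoly k R (n - k + (i + 1)) - a i)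

/-- The ideal `⟨p_{n-k+1} - a_1, …, p_n - a_k⟩`; here `a_i` is indexed by `i = 0, …, k - 1`. -/
def idealP (n : ℕ) (a : Fin k → SymRing k R) : Ideal (SymRing k R) :=
  Ideal.span (Set.range fun i : Fin k => pPoly k R (n - k + (i + 1)) - a i)

/-- The residue classes of the family `f` form an `R`-basis of `𝓢 / K`. -/
def IsBasisMod {ι : Type*} (K : Ideal (SymRing k R)) (f : ι → SymRing k R) : Prop :=
  ∃ b : Module.Basis ι R (SymRing k R ⧸ K), ∀ i, b i = Ideal.Quotient.mk K (f i)

end SymBases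

end

/-! Put `m = n - k`. Call a symmetric polynomial bounded if every variable occurs in it with
exponent at most `m`. Let `g_1, …, g_k` be the given `h`'s or `p`'s, so that `g_i` is homogeneous of
degree `m + i`, and let `u_i = g_i - a_i`. Both parts follow from one criterion
(`isBasisMod_families`), whose only nontrivial hypothesis is that every symmetric polynomial is a
bounded one plus an element of the ideal of the `g_i`.

Linear independence comes from counting; no regular sequence argument is needed. The fundamental
theorem, refined to control exponents (`mem_span_eMon`), writes bounded polynomials in monomials in
the `e_i` of total exponent at most `m`. Taking top-degree components and inducting on the degree,
the hypothesis shows that the products of these `e`-monomials with monomials in the `u_i` span the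
symmetric polynomials, compatibly with the degree filtration (`degLT_le_span_prodFamily`). The
product formula for Gaussian binomials says that in each weight there are exactly as many such
products as `e`-monomials (`exists_boxExp_prod_equiv`). A surjective endomorphism of a finitely
generated module is injective, so the products form a basis (`exists_prodBasis`). Modulo the ideal
of the `u_i`, exactly the products without a factor `u_i` survive (`isBasisMod_eMon`), and these are
the `e_{λ'}`.

The `s_λ` and the `m_λ` with `λ` in the box span all bounded polynomials, hence the quotient, and
they have the same number of elements as the basis just found; surjectivity again gives bijectivity
(`isBasisMod_of_span`).

It remains to check the hypothesis. For the `h`'s, every symmetric polynomial is a combination of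
quotients of alternants by the Vandermonde determinant; such a quotient is bounded if all its
exponents are below `k + m`, and lies in the ideal otherwise (`map_genSchur_eq_zero`). For the
`p`'s, a symmetrized monomial with some exponent above `m` lies in the ideal, by induction on the
number of variables occurring in it (`symmetrize_monomial_mem_pIdeal`); this uses division by
integers. -/

noncomputable section

namespace SymBases

/-! ### Elementary symmetric polynomials, with bounds on degree and exponents -/

section ElementaryBasis

variable {k : ℕ} {R : Type*} [CommRing R]

/-- The symmetric polynomials all of whose monomials have their exponent in `T`. -/
def symSupp (k : ℕ) (R : Type*) [CommRing R] (T : Set (Fin k →₀ ℕ)) :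
    Submodule R (SymRing k R) where
  carrier := {f | ∀ d, coeff d (f : MvPolynomial (Fin k) R) ≠ 0 → d ∈ T}
  zero_mem' := by simp
  add_mem' := by
    intro f g hf hg d hd
    by_cases h : coeff d (f : MvPolynomial (Fin k) R) = 0
    · refine hg d fun h' => hd ?_
      simp [h, h']
    · exact hf d h
  smul_mem' := by
    intro c f hf d hd
    refine hf d fun h => hd ?_
    simp [h]

theorem mem_symSupp {T : Set (Fin k →₀ ℕ)} {f : SymRing k R} :
    f ∈ symSupp k R T ↔ ∀ d, coeff d (f : MvPolynomial (Fin k) R) ≠ 0 → d ∈ T := Iff.rfl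

/-- Exponents of degree less than `D`. -/
def degLT (k D : ℕ) : Set (Fin k →₀ ℕ) := {d | d.degree < D}

/-- Exponents at most `m` in each variable. -/
def expLE (k m : ℕ) : Set (Fin k →₀ ℕ) := {d | ∀ i, d i ≤ m}

theorem mem_symSupp_degLT {D : ℕ} {f : SymRing k R} :
    f ∈ symSupp k R (degLT k (D + 1)) ↔ (f : MvPolynomial (Fin k) R).totalDegree ≤ D := by
  rw [mem_symSupp, totalDegree, Finset.sup_le_iff]
  simp only [degLT, Finsupp.degree_apply, mem_support_iff, Nat.lt_succ_iff, Set.mem_ofPred_eq,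
    Finsupp.sum]

theorem mem_symSupp_expLE {m : ℕ} {f : SymRing k R} :
    f ∈ symSupp k R (expLE k m) ↔ ∀ i, degreeOf i (f : MvPolynomial (Fin k) R) ≤ m := by
  simp only [mem_symSupp, degreeOf_le_iff, mem_support_iff, expLE, Set.mem_ofPred_eq]
  exact ⟨fun h i d hd => h d hd i, fun h d hd i => h i d hd⟩

theorem symSupp_inter (T U : Set (Fin k →₀ ℕ)) :
    symSupp k R (T ∩ U) = symSupp k R T ⊓ symSupp k R U := by
  ext f
  simp only [mem_symSupp, Submodule.mem_inf, Set.mem_inter_iff]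
  exact ⟨fun h => ⟨fun d hd => (h d hd).1, fun d hd => (h d hd).2⟩,
    fun h d hd => ⟨h.1 d hd, h.2 d hd⟩⟩

theorem symSupp_mono {T U : Set (Fin k →₀ ℕ)} (h : T ⊆ U) : symSupp k R T ≤ symSupp k R U :=
  fun _ hf d hd => h (hf d hd)

/-- The monomial `∏ e_{i+1} ^ (c i)` in the elementary symmetric polynomials. -/
def eMon (k : ℕ) (R : Type*) [CommRing R] (c : Fin k →₀ ℕ) : SymRing k R :=
  esymmAlgHom (Fin k) R k (monomial c 1)

theorem coe_eMon (c : Fin k →₀ ℕ) :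
    (eMon k R c : MvPolynomial (Fin k) R) = ∏ i : Fin k, esymm (Fin k) R (i + 1) ^ c i := by
  rw [eMon, esymmAlgHom_apply, aeval_monomial, map_one, one_mul,
    Finsupp.prod_fintype _ _ fun _ => pow_zero _]

/-- The weight `∑ (i + 1) * c i`. -/
def wt (c : Fin k → ℕ) : ℕ := ∑ i : Fin k, ((i : ℕ) + 1) * c i

theorem totalDegree_esymm_le (i : ℕ) : (esymm (Fin k) R i).totalDegree ≤ i := by
  refine (totalDegree_finsetSum _ _).trans (Finset.sup_le fun t ht => ?_)
  refine (totalDegree_finsetProd _ _).trans ?_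
  refine (Finset.sum_le_card_nsmul _ _ 1 fun j _ => ?_).trans ?_
  · exact totalDegree_le_of_support_subset (p := X j) (q := X j) subset_rfl |>.trans (by
      rcases subsingleton_or_nontrivial R with h | h
      · rw [Subsingleton.elim (X j : MvPolynomial (Fin k) R) 0]; simp
      · rw [totalDegree_X])
  · simp [(Finset.mem_powersetCard.1 ht).2]

theorem degreeOf_esymm_le (i : ℕ) (j : Fin k) : degreeOf j (esymm (Fin k) R i) ≤ 1 := by
  rcases subsingleton_or_nontrivial R with h | h
  · rw [Subsingleton.elim (esymm (Fin k) R i) 0]; simp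
  refine (degreeOf_sum_le _ _ _).trans (Finset.sup_le fun t ht => ?_)
  refine (degreeOf_prod_le _ _ _).trans ?_
  simp only [degreeOf_X]
  rw [Finset.sum_ite_eq]
  split_ifs <;> simp

theorem totalDegree_eMon_le (c : Fin k →₀ ℕ) :
    (eMon k R c : MvPolynomial (Fin k) R).totalDegree ≤ wt c := by
  rw [coe_eMon]
  refine (totalDegree_finsetProd _ _).trans (Finset.sum_le_sum fun i _ => ?_)
  refine (totalDegree_pow _ _).trans ?_
  rw [mul_comm]
  exact Nat.mul_le_mul_right _ (totalDegree_esymm_le _)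

theorem degreeOf_eMon_le (c : Fin k →₀ ℕ) (j : Fin k) :
    degreeOf j (eMon k R c : MvPolynomial (Fin k) R) ≤ ∑ i, c i := by
  rw [coe_eMon]
  refine (degreeOf_prod_le _ _ _).trans (Finset.sum_le_sum fun i _ => ?_)
  refine (degreeOf_pow_le _ _ _).trans ?_
  simpa using Nat.mul_le_mul_left (c i) (degreeOf_esymm_le (R := R) (i + 1) j)

/-- If `c i` counts the columns of length `i + 1` of a diagram, `Fin.accumulate` lists its rows;
both sides count the cells. -/
theorem sum_accumulate (c : Fin k → ℕ) : ∑ j, Fin.accumulate k k c j = wt c := by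
  simp only [Fin.accumulate_apply, Finset.sum_filter, wt]
  rw [Finset.sum_comm]
  refine Finset.sum_congr rfl fun i _ => ?_
  rw [← Finset.sum_filter, Finset.sum_const, smul_eq_mul]
  congr 1
  have : (Finset.univ.filter fun j : Fin k => (j : ℕ) ≤ i) = Finset.Iic i := by ext; simp
  rw [this, Fin.card_Iic]

theorem accumulate_zero_eq (c : Fin k → ℕ) (hk : 0 < k) :
    Fin.accumulate k k c ⟨0, hk⟩ = ∑ i, c i := by
  simp [Fin.accumulate_apply]

/-- The refined fundamental theorem: bounds on the degree and on the exponents of a symmetric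
polynomial bound its expression in the elementary symmetric polynomials. -/
theorem mem_span_eMon {D m : ℕ} (f : SymRing k R)
    (hf : f ∈ symSupp k R (degLT k D ∩ expLE k m)) :
    f ∈ Submodule.span R (eMon k R '' {c | wt c < D ∧ ∑ i, c i ≤ m}) := by
  obtain ⟨p, hp⟩ := f
  by_cases h0 : p = 0
  · subst h0; exact Submodule.zero_mem _
  induction he : p.supDegree toLex using WellFoundedLT.induction generalizing p with | _ t ih
  subst he
  have hlc : p.leadingCoeff toLex ≠ 0 := by
    rwa [Ne, AddMonoidAlgebra.leadingCoeff_eq_zero toLex.injective]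
  set lam : Fin k →₀ ℕ := ofLex (p.supDegree toLex) with hlam
  -- The lexicographically leading exponent of a symmetric polynomial is a partition, and `t` is the
  -- exponent of the `e`-monomial leading with it. The weight of `t` is the size of that partition
  -- and its total is the largest part, so subtracting the leading term preserves both bounds.
  let t : Fin k →₀ ℕ := Finsupp.equivFunOnFinite.symm (Fin.invAccumulate k k lam)
  have hacc : Fin.accumulate k k t = lam :=
    Fin.accumulate_invAccumulate le_rfl (IsSymmetric.antitone_supDegree hp)
  have hmem : lam ∈ degLT k D ∩ expLE k m := by
    refine hf lam ?_
    rwa [leadingCoeff_toLex] at hlc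
  have hwt : wt t < D := by
    rw [← sum_accumulate, hacc]
    have := hmem.1
    rwa [degLT, Set.mem_ofPred_eq, Finsupp.degree_eq_sum] at this
  have hbox : ∑ i, t i ≤ m := by
    rcases Nat.eq_zero_or_pos k with hk | hk
    · subst hk; simp
    · rw [← accumulate_zero_eq _ hk, hacc]; exact hmem.2 _
  let q : SymRing k R := p.leadingCoeff toLex • eMon k R t
  have hqspan : q ∈ Submodule.span R (eMon k R '' {c | wt c < D ∧ ∑ i, c i ≤ m}) :=
    Submodule.smul_mem _ _ (Submodule.subset_span ⟨t, ⟨hwt, hbox⟩, rfl⟩)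
  have hqsupp : q ∈ symSupp k R (degLT k D ∩ expLE k m) := by
    refine Submodule.smul_mem _ _ ?_
    rw [symSupp_inter]
    refine ⟨?_, mem_symSupp_expLE.2 fun i => (degreeOf_eMon_le t i).trans hbox⟩
    exact symSupp_mono (fun d (hd : d.degree < wt t + 1) => (by
      show d.degree < D
      omega)) (mem_symSupp_degLT.2 (totalDegree_eMon_le t))
  have hq : (q : MvPolynomial (Fin k) R) =
      esymmAlgHomMonomial (Fin k) t (p.leadingCoeff toLex) := by
    simp only [q, eMon, esymmAlgHomMonomial]
    rw [← map_smul, smul_monomial, smul_eq_mul, mul_one]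
  have hd : (q : MvPolynomial (Fin k) R).supDegree toLex = p.supDegree toLex := by
    rw [← ofLex_inj, DFunLike.ext'_iff, hq, supDegree_esymmAlgHomMonomial hlc _ le_rfl]
    exact hacc
  by_cases hne : p = q
  · have : (⟨p, hp⟩ : SymRing k R) = q := Subtype.ext hne
    rw [this]; exact hqspan
  have hlt := (AddMonoidAlgebra.supDegree_sub_lt_of_leadingCoeff_eq toLex.injective hd.symm
    (by rw [hq, leadingCoeff_esymmAlgHomMonomial t le_rfl])).resolve_right hne
  have := ih _ hlt (p - q) (Subalgebra.sub_mem _ hp q.2)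
    (Submodule.sub_mem _ hf hqsupp) (sub_ne_zero.2 hne) rfl
  have h2 := Submodule.add_mem _ this hqspan
  convert h2 using 1
  exact Subtype.ext (sub_add_cancel p _).symm

/-- The fundamental theorem of symmetric polynomials, as a basis. -/
def eBasis (k : ℕ) (R : Type*) [CommRing R] : Module.Basis (Fin k →₀ ℕ) R (SymRing k R) :=
  (basisMonomials (Fin k) R).map
    (AlgEquiv.ofBijective _ (esymmAlgHom_fin_bijective R k)).toLinearEquiv

theorem eBasis_apply (c : Fin k →₀ ℕ) : eBasis k R c = eMon k R c := by
  simp [eBasis, eMon]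

end ElementaryBasis

/-! ### Generating functions and the Gaussian binomial identity -/

section Counting

/-- The generating function of a weighted type. -/
def genFun {α : Type*} (w : α → ℕ) : PowerSeries ℤ :=
  PowerSeries.mk fun d => (Nat.card {x // w x = d} : ℤ)

/-- All fibres are finite. -/
def FinFib {α : Type*} (w : α → ℕ) : Prop := ∀ d, Finite {x // w x = d}

theorem genFun_bijective {α β : Type*} {w : α → ℕ} {w' : β → ℕ} (f : α → β)
    (hf : Function.Bijective f) (h : ∀ x, w' (f x) = w x) : genFun w = genFun w' := by
  ext d
  simp only [genFun, PowerSeries.coeff_mk]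
  congr 1
  exact Nat.card_congr ((Equiv.ofBijective f hf).subtypeEquiv fun x => by simp [h])

theorem genFun_sum {α β : Type*} {w : α → ℕ} {w' : β → ℕ} (hw : FinFib w) (hw' : FinFib w') :
    genFun (Sum.elim w w') = genFun w + genFun w' := by
  ext d
  simp only [genFun, PowerSeries.coeff_mk, map_add]
  have := hw d
  have := hw' d
  rw [← Nat.cast_add, ← Nat.card_sum]
  congr 1
  exact Nat.card_congr (Equiv.subtypeSum.trans (Equiv.refl _))

theorem genFun_shift {α : Type*} (w : α → ℕ) (j : ℕ) :
    genFun (fun x => w x + j) = PowerSeries.X ^ j * genFun w := by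
  ext d
  rw [PowerSeries.coeff_X_pow_mul']
  simp only [genFun, PowerSeries.coeff_mk]
  split_ifs with h
  · congr 1
    exact Nat.card_congr (Equiv.subtypeEquivRight fun x => by omega)
  · have : IsEmpty {x // w x + j = d} := ⟨fun x => h (x.2 ▸ Nat.le_add_left _ _)⟩
    simp

theorem genFun_prod {α β : Type*} {w : α → ℕ} {w' : β → ℕ} (hw : FinFib w) (hw' : FinFib w') :
    genFun (fun x : α × β => w x.1 + w' x.2) = genFun w * genFun w' := by
  ext d
  rw [PowerSeries.coeff_mul]
  simp only [genFun, PowerSeries.coeff_mk]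
  let e : {x : α × β // w x.1 + w' x.2 = d} ≃
      Σ p : Finset.HasAntidiagonal.antidiagonal d, {x // w x = p.1.1} × {y // w' y = p.1.2} :=
    { toFun := fun x => ⟨⟨(w x.1.1, w' x.1.2), by simpa using x.2⟩, ⟨x.1.1, rfl⟩, ⟨x.1.2, rfl⟩⟩
      invFun := fun x => ⟨(x.2.1.1, x.2.2.1), by
        rw [x.2.1.2, x.2.2.2]; exact Finset.HasAntidiagonal.mem_antidiagonal.1 x.1.2⟩
      left_inv := fun x => rfl
      right_inv := by
        rintro ⟨⟨⟨p, q⟩, hp⟩, ⟨x, hx⟩, ⟨y, hy⟩⟩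
        simp only at hx hy
        subst hx hy
        rfl }
  have : ∀ p : Finset.HasAntidiagonal.antidiagonal d, Finite ({x // w x = p.1.1} × {y // w' y = p.1.2}) :=
    fun p => by
      have := hw p.1.1
      have := hw' p.1.2
      infer_instance
  rw [Nat.card_congr e, Nat.card_sigma]
  simp only [Nat.card_prod, Nat.cast_sum, Nat.cast_mul]
  rw [Finset.sum_coe_sort (Finset.HasAntidiagonal.antidiagonal d)
    fun p => (Nat.card {x // w x = p.1} : ℤ) * (Nat.card {y // w' y = p.2} : ℤ)]

theorem genFun_unique {α : Type*} [Unique α] {w : α → ℕ} (h : w default = 0) : genFun w = 1 := by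
  ext d
  simp only [genFun, PowerSeries.coeff_mk, PowerSeries.coeff_one]
  split_ifs with hd
  · subst hd
    have : Unique {x // w x = 0} := ⟨⟨⟨default, h⟩⟩, fun x => Subtype.ext (Subsingleton.elim _ _)⟩
    simp
  · have : IsEmpty {x // w x = d} :=
      ⟨fun x => hd (by rw [← x.2, Subsingleton.elim x.1 default, h])⟩
    simp

theorem finFib_of_le {α : Type*} {k : ℕ} {w : α → ℕ} (f : α → Fin k → ℕ)
    (hf : Function.Injective f) (h : ∀ x i, f x i ≤ w x) : FinFib w := by
  intro d
  refine Finite.of_injective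
    (fun x : {x // w x = d} => fun i : Fin k => (⟨f x.1 i, by
      have := h x.1 i; have := x.2; omega⟩ : Fin (d + 1))) fun x y hxy => ?_
  refine Subtype.ext (hf ?_)
  funext i
  simpa using congrFun hxy i

theorem finFib_of_finite {α : Type*} [Finite α] (w : α → ℕ) : FinFib w :=
  fun _ => inferInstance

/-- The linear weight of an exponent vector. -/
def linWt {k : ℕ} (v c : Fin k → ℕ) : ℕ := ∑ i, v i * c i

theorem le_linWt {k : ℕ} {v : Fin k → ℕ} (hv : ∀ i, 0 < v i) (c : Fin k → ℕ) (i : Fin k) :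
    c i ≤ linWt v c :=
  (Nat.le_mul_of_pos_left _ (hv i)).trans
    (Finset.single_le_sum (f := fun i => v i * c i) (fun _ _ => Nat.zero_le _) (Finset.mem_univ i))

theorem finFib_linWt {k : ℕ} {v : Fin k → ℕ} (hv : ∀ i, 0 < v i) : FinFib (linWt v) :=
  finFib_of_le id Function.injective_id fun c i => le_linWt hv c i

/-- The geometric series, obtained from splitting `ℕ` into zero and the successors. -/
theorem genFun_mul_right {j : ℕ} (hj : 0 < j) :
    genFun (fun n : ℕ => j * n) * (1 - PowerSeries.X ^ j) = 1 := by
  have h1 : FinFib fun n : ℕ => j * n :=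
    finFib_of_le (k := 1) (fun n _ => n) (fun x y h => congrFun h 0)
      fun n _ => Nat.le_mul_of_pos_left _ hj
  have h2 : FinFib fun n : ℕ => j * n + j :=
    finFib_of_le (k := 1) (fun n _ => n) (fun x y h => congrFun h 0)
      fun n _ => (Nat.le_mul_of_pos_left _ hj).trans (Nat.le_add_right _ _)
  have h3 : genFun (Sum.elim (fun _ : Unit => 0) fun n : ℕ => j * n + j) =
      genFun fun n : ℕ => j * n := by
    refine genFun_bijective (Sum.elim (fun _ => 0) Nat.succ) ⟨?_, ?_⟩ ?_
    · rintro (x | x) (y | y) h <;> simp_all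
    · rintro (_ | n)
      · exact ⟨Sum.inl (), rfl⟩
      · exact ⟨Sum.inr n, rfl⟩
    · rintro (x | x)
      · simp
      · simp [Nat.mul_succ]
  rw [genFun_sum (finFib_of_finite _) h2, genFun_unique rfl, genFun_shift] at h3
  linear_combination -h3

theorem genFun_linWt {k : ℕ} {v : Fin k → ℕ} (hv : ∀ i, 0 < v i) :
    genFun (linWt v) * ∏ i, (1 - PowerSeries.X ^ v i) = 1 := by
  induction k with
  | zero => simp [genFun_unique, linWt]
  | succ k ih =>
    have h : genFun (fun x : ℕ × (Fin k → ℕ) => v 0 * x.1 + linWt (fun i => v i.succ) x.2) =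
        genFun (linWt v) := by
      refine genFun_bijective (Fin.consEquiv fun _ => ℕ) (Equiv.bijective _) fun x => ?_
      simp [linWt, Fin.consEquiv, Fin.sum_univ_succ]
    have h1 : FinFib fun n : ℕ => v 0 * n :=
      finFib_of_le (k := 1) (fun n _ => n) (fun x y h => congrFun h 0)
        fun n _ => Nat.le_mul_of_pos_left _ (hv 0)
    rw [genFun_prod h1 (finFib_linWt fun i => hv i.succ)] at h
    rw [← h, Fin.prod_univ_succ]
    linear_combination (genFun (linWt fun i => v i.succ) * ∏ i : Fin k,
      (1 - PowerSeries.X ^ v i.succ)) * genFun_mul_right (hv 0) + ih fun i => hv i.succ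

/-- Exponent vectors of total degree at most `m`. -/
abbrev BoxExp (k m : ℕ) : Type := {b : Fin k →₀ ℕ // ∑ i, b i ≤ m}

theorem wt_eq_linWt {k : ℕ} (c : Fin k → ℕ) : wt c = linWt (fun i => (i : ℕ) + 1) c := rfl

theorem le_wt {k : ℕ} (c : Fin k → ℕ) (i : Fin k) : c i ≤ wt c :=
  le_linWt (v := fun i => (i : ℕ) + 1) (fun _ => Nat.succ_pos _) c i

theorem finFib_boxExp (k m : ℕ) : FinFib fun b : BoxExp k m => wt b.1 :=
  finFib_of_le (fun b => b.1) (fun _ _ h => Subtype.ext (DFunLike.coe_injective h))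
    fun _ i => le_wt _ i

/-- The `q`-Pascal rule: either the last exponent vanishes and can be dropped, or it can be lowered
by one, which costs weight `k + 1`. -/
theorem genFun_boxExp_succ (k m : ℕ) :
    genFun (fun b : BoxExp (k + 1) (m + 1) => wt b.1) =
      genFun (fun b : BoxExp k (m + 1) => wt b.1) +
        PowerSeries.X ^ (k + 1) * genFun (fun b : BoxExp (k + 1) m => wt b.1) := by
  have h2 : FinFib fun b : BoxExp (k + 1) m => wt b.1 + (k + 1) :=
    finFib_of_le (fun b => b.1) (fun _ _ h => Subtype.ext (DFunLike.coe_injective h))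
      fun b i => (le_wt _ i).trans (Nat.le_add_right _ _)
  rw [← genFun_shift, ← genFun_sum (finFib_boxExp _ _) h2]
  symm
  let f : BoxExp k (m + 1) ⊕ BoxExp (k + 1) m → BoxExp (k + 1) (m + 1) :=
    Sum.elim (fun b => ⟨Finsupp.equivFunOnFinite.symm (Fin.snoc (α := fun _ => ℕ) b.1 0), by
        simpa [Fin.sum_univ_castSucc] using b.2⟩)
      (fun b => ⟨b.1 + Finsupp.single (Fin.last k) 1, by
        simpa [Finset.sum_add_distrib, Finsupp.single_apply] using b.2⟩)
  refine genFun_bijective f ⟨?_, ?_⟩ ?_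
  · have key : ∀ (x : BoxExp k (m + 1)) (y : BoxExp (k + 1) m),
        f (Sum.inl x) ≠ f (Sum.inr y) := fun x y h => by
      have := DFunLike.congr_fun (congrArg Subtype.val h) (Fin.last k)
      simp [f] at this
    rintro (x | x) (y | y) h
    · congr 1
      refine Subtype.ext (Finsupp.ext fun i => ?_)
      have := DFunLike.congr_fun (congrArg Subtype.val h) i.castSucc
      simpa [f] using this
    · exact (key _ _ h).elim
    · exact (key _ _ h.symm).elim
    · congr 1
      refine Subtype.ext ?_
      have := congrArg Subtype.val h
      simpa [f] using this
  · rintro ⟨b, hb⟩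
    by_cases h0 : b (Fin.last k) = 0
    · refine ⟨Sum.inl ⟨Finsupp.equivFunOnFinite.symm fun i => b i.castSucc, ?_⟩, ?_⟩
      · simpa [Fin.sum_univ_castSucc, h0] using hb
      · refine Subtype.ext (Finsupp.ext fun i => ?_)
        refine Fin.lastCases ?_ (fun i => ?_) i <;> simp [f, h0]
    · have hle : Finsupp.single (Fin.last k) 1 ≤ b := by
        rw [Finsupp.single_le_iff]; omega
      have hb' : b - Finsupp.single (Fin.last k) 1 + Finsupp.single (Fin.last k) 1 = b :=
        tsub_add_cancel_of_le hle
      refine ⟨Sum.inr ⟨b - Finsupp.single (Fin.last k) 1, ?_⟩, Subtype.ext hb'⟩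
      rw [← hb'] at hb
      simpa [Finset.sum_add_distrib, Finsupp.single_apply] using hb
  · rintro (x | x)
    · simp [f, wt, Fin.sum_univ_castSucc]
    · simp [f, wt, mul_add, Finset.sum_add_distrib, Finsupp.single_apply]

/-- The product formula for the Gaussian binomial coefficient, by double induction from the
`q`-Pascal rule. -/
theorem genFun_boxExp_mul (k m : ℕ) :
    genFun (fun b : BoxExp k m => wt b.1) *
      ∏ i ∈ Finset.range k, (1 - PowerSeries.X ^ (i + 1)) =
        ∏ i ∈ Finset.range k, (1 - PowerSeries.X ^ (m + i + 1)) := by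
  induction k generalizing m with
  | zero =>
    have : Unique (BoxExp 0 m) := ⟨⟨⟨0, by simp⟩⟩, fun b => Subsingleton.elim _ _⟩
    rw [genFun_unique (by simp [wt])]
    simp
  | succ k ihk =>
    induction m with
    | zero =>
      have : Unique (BoxExp (k + 1) 0) := ⟨⟨⟨0, by simp⟩⟩, fun b => Subtype.ext <|
        Finsupp.ext fun i => by
          have := b.2
          rw [Nat.le_zero, Finset.sum_eq_zero_iff] at this
          simpa using this i (Finset.mem_univ i)⟩
      rw [genFun_unique (by
        rw [Subsingleton.elim (default : BoxExp (k + 1) 0) ⟨0, by simp⟩]; simp [wt])]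
      simp
    | succ m ihm =>
      -- Both sides are the product of `1 - X ^ l` over `l` from `m + 1` to `m + k + 1`.
      have h1 : (∏ i ∈ Finset.range k, (1 - (PowerSeries.X : PowerSeries ℤ) ^ (m + i + 1))) *
          (1 - PowerSeries.X ^ (m + k + 1)) =
          (∏ i ∈ Finset.range k, (1 - (PowerSeries.X : PowerSeries ℤ) ^ (m + 1 + i + 1))) *
            (1 - PowerSeries.X ^ (m + 1)) := by
        rw [← Finset.prod_range_succ fun i => 1 - (PowerSeries.X : PowerSeries ℤ) ^ (m + i + 1),
          Finset.prod_range_succ']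
        congr 1
        exact Finset.prod_congr rfl fun i _ => by congr 2; omega
      rw [genFun_boxExp_succ, add_mul, mul_assoc (PowerSeries.X ^ (k + 1)), ihm,
        Finset.prod_range_succ, ← mul_assoc, ihk, Finset.prod_range_succ, Finset.prod_range_succ,
        h1]
      ring

theorem exists_equiv_of_genFun_eq {α β : Type*} {w : α → ℕ} {w' : β → ℕ} (hw : FinFib w)
    (hw' : FinFib w') (h : genFun w = genFun w') : ∃ e : α ≃ β, ∀ x, w' (e x) = w x := by
  have h1 : ∀ d, Nonempty ({x // w x = d} ≃ {y // w' y = d}) := fun d => by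
    have := hw d
    have := hw' d
    have h2 := congrArg (PowerSeries.coeff d) h
    simp only [genFun, PowerSeries.coeff_mk, Nat.cast_inj] at h2
    exact Finite.card_eq.1 h2
  have e := fun d => (h1 d).some
  refine ⟨(Equiv.sigmaFiberEquiv w).symm.trans
    ((Equiv.sigmaCongrRight e).trans (Equiv.sigmaFiberEquiv w')), fun x => ?_⟩
  exact (e (w x) ⟨x, rfl⟩).2

/-- Pairs of a partition in the box and a multiset of numbers in
`m + 1, …, m + k` are equinumerous with partitions with parts at most `k`, by weight. -/
theorem exists_boxExp_prod_equiv (k m : ℕ) :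
    ∃ e : BoxExp k m × (Fin k →₀ ℕ) ≃ (Fin k →₀ ℕ),
      ∀ x, wt (e x) = wt x.1.1 + linWt (fun i => m + i + 1) x.2 := by
  have hC : FinFib fun c : Fin k →₀ ℕ => linWt (fun i => m + i + 1) c :=
    finFib_of_le (fun c => c) DFunLike.coe_injective fun c i =>
      le_linWt (fun i => Nat.succ_pos _) _ _
  have hN : FinFib fun c : Fin k →₀ ℕ => wt c :=
    finFib_of_le (fun c => c) DFunLike.coe_injective fun c i => le_wt _ _
  have hfun : ∀ v : Fin k → ℕ, genFun (fun c : Fin k →₀ ℕ => linWt v c) = genFun (linWt v) :=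
    fun v => genFun_bijective (fun c => c) Finsupp.equivFunOnFinite.bijective fun _ => rfl
  have hB := genFun_boxExp_mul k m
  rw [← Fin.prod_univ_eq_prod_range (fun i => 1 - PowerSeries.X ^ (i + 1)),
    ← Fin.prod_univ_eq_prod_range (fun i => 1 - PowerSeries.X ^ (m + i + 1))] at hB
  have h1 := genFun_linWt (v := fun i : Fin k => (i : ℕ) + 1) fun _ => Nat.succ_pos _
  have h2 := genFun_linWt (v := fun i : Fin k => m + (i : ℕ) + 1) fun _ => Nat.succ_pos _
  have key : genFun (fun x : BoxExp k m × (Fin k →₀ ℕ) =>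
      wt x.1.1 + linWt (fun i => m + i + 1) x.2) = genFun (fun c : Fin k →₀ ℕ => wt c) := by
    rw [genFun_prod (finFib_boxExp k m) hC, hfun]
    simp only [wt_eq_linWt (k := k)] at hB ⊢
    rw [hfun]
    -- By `h1` and `h2` the two products in `hB` are inverse to the series counting all exponents
    -- and the series counting monomials in the `u_i`; `hB` is multiplied by both series.
    linear_combination (-genFun (fun b : BoxExp k m => linWt (fun i => (i : ℕ) + 1) b.1) *
      genFun (linWt fun i : Fin k => m + (i : ℕ) + 1)) * h1
      + (genFun (linWt fun i : Fin k => (i : ℕ) + 1) *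
      genFun (linWt fun i : Fin k => m + (i : ℕ) + 1)) * hB
      + genFun (linWt fun i : Fin k => (i : ℕ) + 1) * h2
  have hprod : FinFib fun x : BoxExp k m × (Fin k →₀ ℕ) =>
      wt x.1.1 + linWt (fun i => m + i + 1) x.2 := by
    refine finFib_of_le (k := k + k) (fun x => Fin.append (x.1.1 : Fin k → ℕ) x.2) ?_ ?_
    · rintro ⟨⟨b, hb⟩, c⟩ ⟨⟨b', hb'⟩, c'⟩ h
      have h1 : b = b' := Finsupp.ext fun i => by
        simpa using congrFun h (Fin.castAdd k i)
      have h2 : c = c' := Finsupp.ext fun i => by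
        have := congrFun h (Fin.natAdd k i)
        simp only [Fin.append_right] at this
        exact this
      subst h1 h2
      rfl
    · intro x i
      refine Fin.addCases (fun i => ?_) (fun i => ?_) i
      · simpa using (le_wt (x.1.1 : Fin k → ℕ) i).trans (Nat.le_add_right _ _)
      · rw [Fin.append_right]
        exact (le_linWt (v := fun i : Fin k => m + (i : ℕ) + 1)
          (fun _ => Nat.succ_pos _) x.2 i).trans (Nat.le_add_left _ _)
  exact exists_equiv_of_genFun_eq hprod hN key

end Counting

/-! ### The basis of products and the quotient by the deformed ideal -/

section Deformed

variable {k : ℕ} {R : Type*} [CommRing R]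

/-- The homogeneous component of a symmetric polynomial. -/
def homComp (k : ℕ) (R : Type*) [CommRing R] (D : ℕ) : SymRing k R →ₗ[R] SymRing k R where
  toFun f := ⟨homogeneousComponent D (f : MvPolynomial (Fin k) R), fun σ => by
    rw [rename_homogeneousComponent, f.2 σ]⟩
  map_add' f g := Subtype.ext (by simp)
  map_smul' c f := Subtype.ext (by simp)

theorem coe_homComp (D : ℕ) (f : SymRing k R) :
    (homComp k R D f : MvPolynomial (Fin k) R) = homogeneousComponent D f.1 := rfl

theorem homogeneousComponent_mul {σ : Type*} {D e : ℕ} (c : MvPolynomial σ R)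
    {g : MvPolynomial σ R} (hg : g.IsHomogeneous e) :
    homogeneousComponent D (c * g) = if e ≤ D then homogeneousComponent (D - e) c * g else 0 := by
  induction c using MvPolynomial.induction_on' with
  | monomial d r =>
    have h1 : (monomial d r).IsHomogeneous d.degree := isHomogeneous_monomial r rfl
    rw [homogeneousComponent_of_mem (h1.mul hg), homogeneousComponent_of_mem h1]
    split_ifs <;> first | rfl | omega
  | add p q hp hq =>
    rw [add_mul, map_add, hp, hq]
    split_ifs
    · rw [map_add, add_mul]
    · simp

theorem homComp_mem_degLT (D : ℕ) (f : SymRing k R) :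
    homComp k R D f ∈ symSupp k R (degLT k (D + 1)) := by
  intro d hd
  rw [coe_homComp, coeff_homogeneousComponent] at hd
  by_contra h
  exact hd (if_neg fun h' => h (by rw [degLT, Set.mem_ofPred_eq, h']; exact Nat.lt_succ_self _))

theorem homComp_mem (D : ℕ) {T : Set (Fin k →₀ ℕ)} {f : SymRing k R} (hf : f ∈ symSupp k R T) :
    homComp k R D f ∈ symSupp k R T := by
  intro d hd
  rw [coe_homComp, coeff_homogeneousComponent] at hd
  exact hf d fun h => hd (by simp [h])

theorem sub_homComp_mem {D : ℕ} {f : SymRing k R} (hf : f ∈ symSupp k R (degLT k (D + 1))) :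
    f - homComp k R D f ∈ symSupp k R (degLT k D) := by
  intro d hd
  have h : (f - homComp k R D f : SymRing k R).1 = f.1 - homogeneousComponent D f.1 := rfl
  rw [h, coeff_sub, coeff_homogeneousComponent] at hd
  have h1 : d.degree ≠ D := fun h => hd (by simp [h])
  rw [if_neg h1, sub_zero] at hd
  have h2 := hf d hd
  simp only [degLT, Set.mem_ofPred_eq] at h2 ⊢
  omega

theorem mul_mem_degLT {D E : ℕ} {f g : SymRing k R} (hf : f ∈ symSupp k R (degLT k (D + 1)))
    (hg : g ∈ symSupp k R (degLT k E)) : f * g ∈ symSupp k R (degLT k (D + E)) := by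
  rcases E with _ | E
  · have : g = 0 := by
      refine Subtype.ext (MvPolynomial.ext _ _ fun d => ?_)
      by_contra h
      exact absurd (hg d (by simpa using h)) (by simp [degLT])
    rw [this, mul_zero]
    exact Submodule.zero_mem _
  · rw [mem_symSupp_degLT] at hf hg
    exact mem_symSupp_degLT.2 ((totalDegree_mul _ _).trans (add_le_add hf hg))

theorem mem_degLT_self (f : SymRing k R) :
    f ∈ symSupp k R (degLT k ((f : MvPolynomial (Fin k) R).totalDegree + 1)) :=
  mem_symSupp_degLT.2 le_rfl

theorem degLT_subset_span (D : ℕ) :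
    symSupp k R (degLT k D) = Submodule.span R (eMon k R '' {c | wt c < D}) := by
  refine le_antisymm (fun f hf => ?_) (Submodule.span_le.2 ?_)
  · let m := (f : MvPolynomial (Fin k) R).totalDegree
    have hm : f ∈ symSupp k R (expLE k m) :=
      mem_symSupp_expLE.2 fun i => degreeOf_le_totalDegree _ _
    refine Submodule.span_mono (Set.image_mono fun c hc => hc.1)
      (mem_span_eMon (D := D) (m := m) f ?_)
    rw [symSupp_inter]
    exact ⟨hf, hm⟩
  · rintro _ ⟨c, hc, rfl⟩
    exact symSupp_mono (fun d (hd : d.degree < wt c + 1) => show d.degree < D by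
      have : wt c < D := hc
      omega) (mem_symSupp_degLT.2 (totalDegree_eMon_le c))

theorem finite_wt_lt (k D : ℕ) : {c : Fin k →₀ ℕ | wt c < D}.Finite := by
  have : Set.Finite (⋃ d ∈ Finset.range D, {c : Fin k →₀ ℕ | wt c = d}) := by
    refine Set.Finite.biUnion (Finset.finite_toSet _) fun d _ => ?_
    exact (finFib_of_le (w := fun c : Fin k →₀ ℕ => wt c) (fun c => c) DFunLike.coe_injective
      (fun c i => le_wt _ _) d : Finite {c : Fin k →₀ ℕ // wt c = d})
  refine this.subset fun c hc => ?_
  simp only [Set.mem_iUnion]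
  exact ⟨wt c, Finset.mem_range.2 hc, rfl⟩

section Deformation

variable {m : ℕ}

/-- The products of an element of the box family and a monomial in the sequence `u`. -/
def prodFamily (m : ℕ) (u : Fin k → SymRing k R) (x : BoxExp k m × (Fin k →₀ ℕ)) : SymRing k R :=
  eMon k R x.1.1 * ∏ i, u i ^ x.2 i

/-- The weight of such a product. -/
def prodWt (x : BoxExp k m × (Fin k →₀ ℕ)) : ℕ := wt x.1.1 + linWt (fun i => m + i + 1) x.2

theorem prodFamily_mul (u : Fin k → SymRing k R) (b : BoxExp k m) (c : Fin k →₀ ℕ) (i : Fin k) :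
    prodFamily m u (b, c) * u i = prodFamily m u (b, c + Finsupp.single i 1) := by
  simp only [prodFamily, Finsupp.add_apply, pow_add, Finset.prod_mul_distrib, mul_assoc]
  congr 2
  rw [Finset.prod_eq_single i]
  · simp
  · intro j _ hj
    rw [Finsupp.single_eq_of_ne hj, pow_zero]
  · simp

theorem prodWt_add_single (b : BoxExp k m) (c : Fin k →₀ ℕ) (i : Fin k) :
    prodWt (b, c + Finsupp.single i 1) = prodWt (b, c) + (m + i + 1) := by
  simp only [prodWt, linWt, Finsupp.add_apply, mul_add, Finset.sum_add_distrib, add_assoc]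
  congr 2
  rw [Finset.sum_eq_single i]
  · simp
  · intro j _ hj
    rw [Finsupp.single_eq_of_ne hj, mul_zero]
  · simp

theorem totalDegree_prodFamily_le {u : Fin k → SymRing k R}
    (hu : ∀ i, (u i : MvPolynomial (Fin k) R).totalDegree ≤ m + i + 1)
    (x : BoxExp k m × (Fin k →₀ ℕ)) :
    (prodFamily m u x : MvPolynomial (Fin k) R).totalDegree ≤ prodWt x := by
  have : (prodFamily m u x : MvPolynomial (Fin k) R) =
      (eMon k R x.1.1 : MvPolynomial (Fin k) R) * ∏ i, (u i : MvPolynomial (Fin k) R) ^ x.2 i := by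
    simp [prodFamily]
  rw [this]
  refine (totalDegree_mul _ _).trans (add_le_add (totalDegree_eMon_le _) ?_)
  refine (totalDegree_finsetProd _ _).trans (Finset.sum_le_sum fun i _ => ?_)
  refine (totalDegree_pow _ _).trans ?_
  rw [mul_comm]
  exact Nat.mul_le_mul_right _ (hu i)

variable {g a : Fin k → SymRing k R}

/-- Strong induction on the degree bound: replacing `g i` by `g i - a i` changes only terms of lower
degree. -/
theorem degLT_le_span_prodFamily
    (hg : ∀ i, (g i : MvPolynomial (Fin k) R).IsHomogeneous (m + i + 1))
    (ha : ∀ i : Fin k, a i ∈ symSupp k R (degLT k (m + i + 1)))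
    (hK : ∀ f : SymRing k R, ∃ v ∈ symSupp k R (expLE k m), ∃ c : Fin k → SymRing k R,
      f = v + ∑ i, c i * g i) (D : ℕ) :
    symSupp k R (degLT k D) ≤
      Submodule.span R (prodFamily m (fun i => g i - a i) '' {x | prodWt x < D}) := by
  induction D using Nat.strong_induction_on with
  | _ D ih =>
  intro f hf
  rcases D with _ | D
  · have : f = 0 := by
      refine Subtype.ext (MvPolynomial.ext _ _ fun d => ?_)
      by_contra h
      exact absurd (hf d (by simpa using h)) (by simp [degLT])
    rw [this]
    exact Submodule.zero_mem _
  set N := Submodule.span R (prodFamily m (fun i => g i - a i) '' {x | prodWt x < D + 1}) with hN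
  have hmono : ∀ E, E ≤ D + 1 →
      Submodule.span R (prodFamily m (fun i => g i - a i) '' {x | prodWt x < E}) ≤ N :=
    fun E hE => Submodule.span_mono (Set.image_mono fun x (hx : _ < _) => hx.trans_le hE)
  obtain ⟨v, hv, c, hfc⟩ := hK f
  -- Only the component of `c i` of degree `D - (m + i + 1)` contributes to degree `D`; the case
  -- distinction guards against truncated subtraction.
  let c' : Fin k → SymRing k R := fun i =>
    if m + i + 1 ≤ D then homComp k R (D - (m + i + 1)) (c i) else 0
  have hcomp : homComp k R D f = homComp k R D v + ∑ i, c' i * g i := by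
    have h1 : ∀ i, homComp k R D (c i * g i) = c' i * g i := fun i => by
      refine Subtype.ext ?_
      rw [coe_homComp]
      simp only [c']
      refine (homogeneousComponent_mul (c i).1 (hg i)).trans ?_
      split_ifs with h
      · rfl
      · rw [zero_mul]; rfl
    conv_lhs => rw [hfc]
    rw [map_add, map_sum]
    simp only [h1]
  -- The three summands are a bounded polynomial, covered by `mem_span_eMon`; multiples of the
  -- generators, whose cofactors are covered by induction; and an error of degree below `D`.
  have hdecomp : f = homComp k R D v + ∑ i, c' i * (g i - a i) +
      ((f - homComp k R D f) + ∑ i, c' i * a i) := by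
    rw [hcomp]
    simp only [mul_sub, Finset.sum_sub_distrib]
    ring
  rw [hdecomp]
  refine Submodule.add_mem _ (Submodule.add_mem _ ?_ ?_) ?_
  · have h1 : homComp k R D v ∈ symSupp k R (degLT k (D + 1) ∩ expLE k m) := by
      rw [symSupp_inter]
      exact ⟨homComp_mem_degLT D v, homComp_mem D hv⟩
    refine Submodule.span_mono ?_ (mem_span_eMon _ h1)
    rintro _ ⟨b, hb, rfl⟩
    refine ⟨(⟨b, hb.2⟩, 0), ?_, ?_⟩
    · simpa [prodWt, linWt] using hb.1
    · simp [prodFamily]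
  · refine Submodule.sum_mem _ fun i _ => ?_
    by_cases h : m + i + 1 ≤ D
    · have h2 := ih (D - (m + i + 1) + 1) (by omega) (homComp_mem_degLT _ (c i))
      simp only [c', if_pos h]
      generalize homComp k R (D - (m + i + 1)) (c i) = y at h2 ⊢
      induction h2 using Submodule.span_induction with
      | mem x hx =>
        obtain ⟨⟨b, e⟩, hx, rfl⟩ := hx
        rw [prodFamily_mul]
        refine Submodule.subset_span ⟨_, ?_, rfl⟩
        simp only [Set.mem_ofPred_eq, prodWt_add_single] at hx ⊢
        omega
      | zero => rw [zero_mul]; exact Submodule.zero_mem _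
      | add x y _ _ hx hy => rw [add_mul]; exact Submodule.add_mem _ hx hy
      | smul r x _ hx => rw [smul_mul_assoc]; exact Submodule.smul_mem _ _ hx
    · simp only [c', if_neg h, zero_mul]
      exact Submodule.zero_mem _
  · refine hmono D (Nat.le_succ D) (ih D (Nat.lt_succ_self D) ?_)
    refine Submodule.add_mem _ (sub_homComp_mem hf) (Submodule.sum_mem _ fun i _ => ?_)
    by_cases h : m + i + 1 ≤ D
    · simp only [c', if_pos h]
      have := mul_mem_degLT (homComp_mem_degLT (D - (m + i + 1)) (c i)) (ha i)
      rwa [Nat.sub_add_cancel h] at this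
    · simp only [c', if_neg h, zero_mul]
      exact Submodule.zero_mem _

/-- The products form a basis of the ring of symmetric polynomials. -/
theorem exists_prodBasis
    (hg : ∀ i, (g i : MvPolynomial (Fin k) R).IsHomogeneous (m + i + 1))
    (ha : ∀ i : Fin k, a i ∈ symSupp k R (degLT k (m + i + 1)))
    (hK : ∀ f : SymRing k R, ∃ v ∈ symSupp k R (expLE k m), ∃ c : Fin k → SymRing k R,
      f = v + ∑ i, c i * g i) :
    ∃ B : Module.Basis (BoxExp k m × (Fin k →₀ ℕ)) R (SymRing k R),
      ∀ x, B x = prodFamily m (fun i => g i - a i) x := by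
  obtain ⟨e, he⟩ := exists_boxExp_prod_equiv k m
  set G := prodFamily m (fun i => g i - a i) with hG
  have hdeg : ∀ x, (G x : MvPolynomial (Fin k) R).totalDegree ≤ prodWt x :=
    totalDegree_prodFamily_le fun i => (totalDegree_sub _ _).trans
      (max_le (hg i).totalDegree_le
        (mem_symSupp_degLT.1 (symSupp_mono (fun d (hd : _ < _) => Nat.lt_succ_of_lt hd) (ha i))))
  -- The weight-preserving bijection turns the claim into bijectivity of an endomorphism that maps
  -- each step of the degree filtration onto itself.
  let φ : SymRing k R →ₗ[R] SymRing k R := (eBasis k R).constr R (G ∘ e.symm)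
  have hφ : ∀ c, φ (eMon k R c) = G (e.symm c) := fun c => by
    rw [← eBasis_apply]; exact (eBasis k R).constr_basis R _ c
  have hwt : ∀ c, prodWt (e.symm c) = wt c := fun c => by
    rw [← e.apply_symm_apply c, he, e.apply_symm_apply]; rfl
  have hmap : ∀ D, (symSupp k R (degLT k D)).map φ = symSupp k R (degLT k D) := by
    intro D
    have himg : φ '' (eMon k R '' {c | wt c < D}) = G '' {x | prodWt x < D} := by
      ext y
      constructor
      · rintro ⟨_, ⟨c, hc, rfl⟩, rfl⟩
        exact ⟨e.symm c, by rw [Set.mem_ofPred_eq, hwt]; exact hc, (hφ c).symm⟩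
      · rintro ⟨x, hx, rfl⟩
        refine ⟨_, ⟨e x, ?_, rfl⟩, by rw [hφ, e.symm_apply_apply]⟩
        rw [Set.mem_ofPred_eq, ← hwt, e.symm_apply_apply]; exact hx
    refine le_antisymm ?_ ?_
    · rw [degLT_subset_span, Submodule.map_span, himg, ← degLT_subset_span, Submodule.span_le]
      rintro _ ⟨x, hx, rfl⟩
      exact symSupp_mono (fun d (hd : d.degree < prodWt x + 1) => show d.degree < D by
        have : prodWt x < D := hx
        omega) (mem_symSupp_degLT.2 (hdeg x))
    · refine (degLT_le_span_prodFamily hg ha hK D).trans_eq ?_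
      rw [degLT_subset_span, Submodule.map_span, himg]
  have hinj : Function.Injective φ := by
    rw [injective_iff_map_eq_zero]
    intro f hf
    obtain ⟨D, hD⟩ : ∃ D, f ∈ symSupp k R (degLT k D) := ⟨_, mem_degLT_self f⟩
    set M := symSupp k R (degLT k D) with hM
    have hle : ∀ x ∈ M, φ x ∈ M := fun x hx => by
      rw [hM, ← hmap D]; exact Submodule.mem_map_of_mem hx
    have : Module.Finite R M := by
      rw [Module.Finite.iff_fg, hM, degLT_subset_span]
      exact Submodule.fg_span ((finite_wt_lt k D).image _)
    have hsurj : Function.Surjective (φ.restrict hle) := by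
      rintro ⟨y, hy⟩
      rw [hM, ← hmap D] at hy
      obtain ⟨x, hx, rfl⟩ := hy
      exact ⟨⟨x, hx⟩, rfl⟩
    -- The whole ring need not be a finitely generated module, so this is applied to a filtration
    -- step containing `f`.
    have := OrzechProperty.injective_of_surjective_endomorphism _ hsurj
    have h0 : (⟨f, hD⟩ : M) = 0 := this (Subtype.ext (by simpa using hf))
    exact congrArg Subtype.val h0
  have hsurj : Function.Surjective φ := fun f => by
    have := mem_degLT_self f
    rw [← hmap] at this
    obtain ⟨x, -, hx⟩ := this
    exact ⟨x, hx⟩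
  refine ⟨((eBasis k R).map (LinearEquiv.ofBijective φ ⟨hinj, hsurj⟩)).reindex e.symm,
    fun x => ?_⟩
  rw [Module.Basis.reindex_apply, Module.Basis.map_apply, eBasis_apply]
  exact (hφ _).trans (by simp)

/-- In the basis of products, multiplication by a generator raises an exponent of the second factor.
Hence the ideal is spanned by the products with nontrivial second factor. -/
theorem isBasisMod_eMon
    (hg : ∀ i, (g i : MvPolynomial (Fin k) R).IsHomogeneous (m + i + 1))
    (ha : ∀ i : Fin k, a i ∈ symSupp k R (degLT k (m + i + 1)))
    (hK : ∀ f : SymRing k R, ∃ v ∈ symSupp k R (expLE k m), ∃ c : Fin k → SymRing k R,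
      f = v + ∑ i, c i * g i) :
    IsBasisMod (Ideal.span (Set.range fun i => g i - a i))
      (fun b : BoxExp k m => eMon k R b.1) := by
  obtain ⟨B, hB⟩ := exists_prodBasis hg ha hK
  set I := Ideal.span (Set.range fun i => g i - a i) with hI
  -- The projection onto the products without generator factors; it vanishes on the ideal, and the
  -- induced map on the quotient detects linear independence.
  let π : SymRing k R →ₗ[R] (BoxExp k m →₀ R) :=
    B.constr R fun x => if x.2 = 0 then Finsupp.single x.1 1 else 0
  have hπ : ∀ x, π (prodFamily m (fun i => g i - a i) x) =
      if x.2 = 0 then Finsupp.single x.1 1 else 0 := fun x => by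
    rw [← hB]; exact B.constr_basis R _ x
  have hker : ∀ f ∈ I, π f = 0 := by
    intro f hf
    rw [hI, Ideal.mem_span_range_iff_exists_fun] at hf
    obtain ⟨c, rfl⟩ := hf
    rw [map_sum]
    refine Finset.sum_eq_zero fun i _ => ?_
    have hc : c i ∈ Submodule.span R (Set.range B) := by rw [B.span_eq]; trivial
    generalize c i = y at hc ⊢
    induction hc using Submodule.span_induction with
    | mem x hx =>
      obtain ⟨⟨b, e⟩, rfl⟩ := hx
      rw [hB, prodFamily_mul (fun i => g i - a i), hπ, if_neg]
      intro h
      simpa using DFunLike.congr_fun h i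
    | zero => simp
    | add x y _ _ hx hy => rw [add_mul, map_add, hx, hy, add_zero]
    | smul r x _ hx => rw [smul_mul_assoc, map_smul, hx, smul_zero]
  have hmk0 : ∀ b : BoxExp k m, prodFamily m (fun i => g i - a i) (b, 0) = eMon k R b.1 :=
    fun b => by simp [prodFamily]
  let π' : (SymRing k R ⧸ I) →ₗ[R] (BoxExp k m →₀ R) :=
    Submodule.liftQ (I.restrictScalars R) π hker
  let q : SymRing k R →ₗ[R] (SymRing k R ⧸ I) := (Ideal.Quotient.mkₐ R I).toLinearMap
  have hπ' : ∀ b : BoxExp k m, π' (q (eMon k R b.1)) = Finsupp.single b 1 := fun b => by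
    have : π' (q (eMon k R b.1)) = π (eMon k R b.1) := rfl
    rw [this, ← hmk0, hπ, if_pos rfl]
  have hli : LinearIndependent R fun b : BoxExp k m => q (eMon k R b.1) := by
    refine LinearIndependent.of_comp π' ?_
    have : (π' ∘ fun b : BoxExp k m => q (eMon k R b.1)) = fun b => Finsupp.single b 1 :=
      funext hπ'
    rw [this]
    have := (Finsupp.basisSingleOne (R := R) (ι := BoxExp k m)).linearIndependent
    simpa using this
  refine ⟨Module.Basis.mk hli ?_, fun b => by simp [q]⟩
  rintro y -
  obtain ⟨f, rfl⟩ := Ideal.Quotient.mk_surjective y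
  have hf : f ∈ Submodule.span R (Set.range B) := by rw [B.span_eq]; trivial
  have hfq : q f ∈ Submodule.span R (Set.range fun b : BoxExp k m => q (eMon k R b.1)) := by
    induction hf using Submodule.span_induction with
    | mem x hx =>
      obtain ⟨⟨b, c⟩, rfl⟩ := hx
      rw [hB]
      by_cases hc : c = 0
      · subst hc
        rw [hmk0]
        exact Submodule.subset_span ⟨b, rfl⟩
      · obtain ⟨i, hi⟩ := Finsupp.ne_iff.1 hc
        have hle : Finsupp.single i 1 ≤ c := by
          rw [Finsupp.single_le_iff]
          simp at hi
          omega
        rw [← tsub_add_cancel_of_le hle, ← prodFamily_mul (fun i => g i - a i)]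
        have : q (prodFamily m (fun i => g i - a i) (b, c - Finsupp.single i 1) *
            (g i - a i)) = 0 :=
          Ideal.Quotient.eq_zero_iff_mem.2
            (I.mul_mem_left _ (Ideal.subset_span ⟨i, rfl⟩))
        rw [this]
        exact Submodule.zero_mem _
    | zero => rw [map_zero]; exact Submodule.zero_mem _
    | add x y _ _ hx hy => rw [map_add]; exact Submodule.add_mem _ hx hy
    | smul r x _ hx => rw [map_smul]; exact Submodule.smul_mem _ _ hx
  exact hfq

end Deformation

end Deformed

/-! ### Partitions in the box, and transfer of the basis to other families -/

section Families

variable {k m : ℕ} {R : Type*} [CommRing R]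

section Diagrams

theorem Box.rowLen_eq_zero (μ : Box k m) {i : ℕ} (hi : k ≤ i) : μ.1.rowLen i = 0 := by
  by_contra h
  have h1 : (i, 0) ∈ μ.1 := YoungDiagram.mem_iff_lt_rowLen.2 (Nat.pos_of_ne_zero h)
  have := YoungDiagram.mem_iff_lt_colLen.1 h1
  have := μ.2.1
  omega

theorem Box.rowLen_le (μ : Box k m) (i : ℕ) : μ.1.rowLen i ≤ m :=
  (μ.1.rowLen_anti 0 i (Nat.zero_le _)).trans μ.2.2

theorem Box.ext_rowLen {μ ν : Box k m} (h : ∀ i : Fin k, μ.1.rowLen i = ν.1.rowLen i) : μ = ν := by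
  have h1 : ∀ i, μ.1.rowLen i = ν.1.rowLen i := fun i => by
    rcases lt_or_ge i k with hi | hi
    · exact h ⟨i, hi⟩
    · rw [μ.rowLen_eq_zero hi, ν.rowLen_eq_zero hi]
  refine Subtype.ext (YoungDiagram.ext (Finset.ext fun ⟨i, j⟩ => ?_))
  rw [YoungDiagram.mem_cells, YoungDiagram.mem_cells, YoungDiagram.mem_iff_lt_rowLen,
    YoungDiagram.mem_iff_lt_rowLen, h1]

theorem exists_box (lam : Fin k → ℕ) (h : Antitone lam) (hm : ∀ i, lam i ≤ m) :
    ∃ μ : Box k m, ∀ i : Fin k, μ.1.rowLen i = lam i := by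
  have hs : (List.ofFn lam).SortedGE := List.sortedGE_ofFn_iff.2 h
  let μ := YoungDiagram.ofRowLens _ hs
  have hmem : ∀ i j, (i, j) ∈ μ ↔ ∃ h : i < k, j < lam ⟨i, h⟩ := fun i j => by
    simp only [μ]
    rw [YoungDiagram.mem_ofRowLens]
    simp
  have hrow : ∀ i (hi : i < k), μ.rowLen i = lam ⟨i, hi⟩ := fun i hi =>
    eq_of_forall_lt_iff fun j => by
      rw [← YoungDiagram.mem_iff_lt_rowLen, hmem]
      exact ⟨fun h => h.2, fun h => ⟨hi, h⟩⟩
  refine ⟨⟨μ, ?_, ?_⟩, fun i => hrow i i.2⟩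
  · by_contra! hlt
    obtain ⟨h1, -⟩ := (hmem _ _).1 (YoungDiagram.mem_iff_lt_colLen.2 hlt)
    exact lt_irrefl _ h1
  · by_contra! hlt
    obtain ⟨h1, h2⟩ := (hmem _ _).1 (YoungDiagram.mem_iff_lt_rowLen.2 hlt)
    exact absurd h2 (hm _).not_gt

/-- The multiplicities of the column lengths. -/
def boxToExp (k m : ℕ) (μ : Box k m) : BoxExp k m :=
  ⟨Finsupp.equivFunOnFinite.symm (Fin.invAccumulate k k fun i : Fin k => μ.1.rowLen i), by
    rcases Nat.eq_zero_or_pos k with rfl | hk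
    · simp
    · rw [← accumulate_zero_eq _ hk]
      refine le_trans (le_of_eq ?_) μ.2.2
      exact congrFun (Fin.accumulate_invAccumulate le_rfl
        fun _ _ hij => μ.1.rowLen_anti _ _ hij) ⟨0, hk⟩⟩

theorem accumulate_boxToExp (μ : Box k m) :
    Fin.accumulate k k (boxToExp k m μ).1 = fun i : Fin k => μ.1.rowLen i :=
  Fin.accumulate_invAccumulate le_rfl fun _ _ hij => μ.1.rowLen_anti _ _ hij

theorem boxToExp_bijective (k m : ℕ) : Function.Bijective (boxToExp k m) := by
  constructor
  · intro μ ν h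
    refine Box.ext_rowLen fun i => ?_
    have h1 := congrFun (accumulate_boxToExp μ) i
    have h2 := congrFun (accumulate_boxToExp ν) i
    rw [h] at h1
    exact h1.symm.trans h2
  · rintro ⟨b, hb⟩
    have hanti : Antitone (Fin.accumulate k k b) := fun i j hij => by
      simp only [Fin.accumulate_apply]
      refine Finset.sum_le_sum_of_subset fun l hl => ?_
      simp only [Finset.mem_filter, Finset.mem_univ, true_and] at hl ⊢
      exact (Fin.le_def.1 hij).trans hl
    obtain ⟨μ, hμ⟩ := exists_box (m := m) _ hanti fun i => by
      rw [Fin.accumulate_apply]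
      exact (Finset.sum_le_sum_of_subset (Finset.filter_subset _ _)).trans hb
    refine ⟨μ, Subtype.ext (DFunLike.coe_injective (Fin.accumulate_injective le_rfl ?_))⟩
    rw [accumulate_boxToExp]
    exact funext hμ

/-- Young diagrams in the box correspond to multiplicities of column lengths. -/
def boxEquiv (k m : ℕ) : Box k m ≃ BoxExp k m := Equiv.ofBijective _ (boxToExp_bijective k m)

instance : Finite (BoxExp k m) := by
  refine Finite.of_injective (fun (b : BoxExp k m) (i : Fin k) => (⟨b.1 i, Nat.lt_succ_of_le ((Finset.single_le_sum (f := fun i => b.1 i)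
      (fun _ _ => Nat.zero_le _) (Finset.mem_univ i)).trans b.2)⟩ : Fin (m + 1)))
    fun b c h => Subtype.ext (Finsupp.ext fun i => ?_)
  simpa using congrFun h i

instance : Finite (Box k m) := Finite.of_equiv _ (boxEquiv k m).symm

/-- The parts of the conjugate are the column lengths, and a column of length `i + 1` occurs `rowLen
i - rowLen (i + 1)` times. -/
theorem ePoly_transpose (μ : Box k m) :
    ePoly k R μ.1.transpose = eMon k R (boxEquiv k m μ).1 := by
  refine Subtype.ext ?_
  rw [coe_eMon]
  have h1 : ((ePoly k R μ.1.transpose : SymRing k R) : MvPolynomial (Fin k) R) =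
      ∏ j ∈ Finset.range (μ.1.rowLen 0), esymm (Fin k) R (μ.1.colLen j) := by
    simp only [ePoly, YoungDiagram.rowLens, YoungDiagram.colLen_transpose, List.map_map]
    rw [← Subalgebra.coe_val, map_list_prod, List.map_map, Finset.prod_range,
      ← List.prod_ofFn, List.ofFn_eq_map, ← List.map_coe_finRange_eq_range, List.map_map]
    congr 2
    funext j
    simp
  have hpos : ∀ j ∈ Finset.range (μ.1.rowLen 0), 0 < μ.1.colLen j := fun j hj => by
    rw [← YoungDiagram.mem_iff_lt_colLen, YoungDiagram.mem_iff_lt_rowLen]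
    exact Finset.mem_range.1 hj
  have hle : ∀ j, μ.1.colLen j ≤ k := fun j => (μ.1.colLen_anti 0 j (Nat.zero_le _)).trans μ.2.1
  -- Columns are grouped by length minus one; by `hpos` no column in the range is empty, so the
  -- subtraction does not truncate.
  rw [h1, ← Finset.prod_fiberwise_of_maps_to (t := Finset.range k)
    (g := fun j => μ.1.colLen j - 1), Finset.prod_range]
  · refine Finset.prod_congr rfl fun i _ => ?_
    have h2 : (boxEquiv k m μ).1 i = μ.1.rowLen i - μ.1.rowLen (i + 1) := by
      show Fin.invAccumulate k k (fun i : Fin k => μ.1.rowLen i) i = _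
      rw [Fin.invAccumulate, dif_pos i.2]
      split_ifs with h
      · rfl
      · rw [μ.rowLen_eq_zero (not_lt.1 h)]
    have h3 : (Finset.range (μ.1.rowLen 0)).filter (fun j => μ.1.colLen j - 1 = i) =
        Finset.Ico (μ.1.rowLen (i + 1)) (μ.1.rowLen i) := by
      ext j
      rw [Finset.mem_filter, Finset.mem_Ico, ← not_lt, ← YoungDiagram.mem_iff_lt_rowLen,
        ← YoungDiagram.mem_iff_lt_rowLen, YoungDiagram.mem_iff_lt_colLen,
        YoungDiagram.mem_iff_lt_colLen]
      constructor
      · rintro ⟨hj, h⟩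
        have := hpos j hj
        omega
      · rintro ⟨h4, h5⟩
        refine ⟨?_, by omega⟩
        rw [Finset.mem_range, ← YoungDiagram.mem_iff_lt_rowLen, YoungDiagram.mem_iff_lt_colLen]
        omega
    rw [h2, h3, ← Nat.card_Ico, ← Finset.prod_const]
    refine Finset.prod_congr rfl fun j hj => ?_
    rw [← h3, Finset.mem_filter] at hj
    have := hpos j hj.1
    congr 1
    omega
  · intro j hj
    have := hpos j hj
    have := hle j
    rw [Finset.mem_range]
    omega

end Diagrams

theorem eMon_mem_expLE (b : BoxExp k m) : eMon k R b.1 ∈ symSupp k R (expLE k m) :=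
  mem_symSupp_expLE.2 fun _ => (degreeOf_eMon_le _ _).trans b.2

/-- A family that spans the polynomials with exponents at most `m` and has the right cardinality is
a basis. -/
theorem isBasisMod_of_span {K : Ideal (SymRing k R)}
    (hK : IsBasisMod K fun b : BoxExp k m => eMon k R b.1) {f : Box k m → SymRing k R}
    (hf : symSupp k R (expLE k m) ≤ Submodule.span R (Set.range f)) : IsBasisMod K f := by
  obtain ⟨B, hB⟩ := hK
  let q : SymRing k R →ₗ[R] (SymRing k R ⧸ K) := (Ideal.Quotient.mkₐ R K).toLinearMap
  let T : (SymRing k R ⧸ K) →ₗ[R] (SymRing k R ⧸ K) :=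
    B.constr R fun b => q (f ((boxEquiv k m).symm b))
  have hT : ∀ b, T (B b) = q (f ((boxEquiv k m).symm b)) := fun b => B.constr_basis R _ b
  have : Module.Finite R (SymRing k R ⧸ K) := Module.Finite.of_basis B
  -- The basis consists of classes of bounded polynomials, so it lies in the span of the classes of
  -- `f`, which is contained in the range of `T`.
  have hsurj : Function.Surjective T := by
    rw [← LinearMap.range_eq_top, eq_top_iff, ← B.span_eq, Submodule.span_le]
    rintro _ ⟨b, rfl⟩
    have h1 : q (eMon k R b.1) ∈ (Submodule.span R (Set.range f)).map q :=
      Submodule.mem_map_of_mem (hf (eMon_mem_expLE b))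
    rw [Submodule.map_span] at h1
    rw [hB]
    refine (Submodule.span_le.2 ?_ :
      Submodule.span R (q '' Set.range f) ≤ LinearMap.range T) h1
    rintro _ ⟨_, ⟨μ, rfl⟩, rfl⟩
    exact ⟨B (boxEquiv k m μ), by rw [hT, Equiv.symm_apply_apply]⟩
  have hbij := OrzechProperty.bijective_of_surjective_endomorphism T hsurj
  refine ⟨(B.map (LinearEquiv.ofBijective T hbij)).reindex (boxEquiv k m).symm, fun μ => ?_⟩
  rw [Module.Basis.reindex_apply, Module.Basis.map_apply]
  exact (hT _).trans (by simp [q])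

theorem isBasisMod_ePoly {K : Ideal (SymRing k R)}
    (hK : IsBasisMod K fun b : BoxExp k m => eMon k R b.1) :
    IsBasisMod K fun μ : Box k m => ePoly k R μ.1.transpose := by
  obtain ⟨B, hB⟩ := hK
  refine ⟨B.reindex (boxEquiv k m).symm, fun μ => ?_⟩
  rw [Module.Basis.reindex_apply, hB, Equiv.symm_symm]
  exact congrArg _ (ePoly_transpose μ).symm

/-! ### Monomial symmetric polynomials -/

section Monomial

theorem exists_perm_antitone (d : Fin k → ℕ) : ∃ σ : Equiv.Perm (Fin k), Antitone (d ∘ σ) :=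
  ⟨Fin.revPerm.trans (Tuple.sort d), fun _ _ hij =>
    Tuple.monotone_sort d (Fin.rev_le_rev.2 hij)⟩

/-- The multiset of nonzero entries of an exponent. -/
def expParts (d : Fin k →₀ ℕ) : Multiset ℕ := d.support.val.map d

theorem expParts_eq (d : Fin k →₀ ℕ) :
    expParts d = ((Finset.univ : Finset (Fin k)).val.map d).filter (· ≠ 0) := by
  rw [Multiset.filter_map, expParts]
  congr 1
  have : d.support = Finset.univ.filter fun i => d i ≠ 0 := by ext; simp
  rw [this]
  rfl

theorem rowLens_eq (μ : Box k m) : (μ.1.rowLens : Multiset ℕ) =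
    ((Finset.univ : Finset (Fin k)).val.map fun i : Fin k => μ.1.rowLen i).filter (· ≠ 0) := by
  have h1 : (Finset.univ : Finset (Fin k)).val.map (fun i : Fin k => μ.1.rowLen i) =
      (Multiset.range k).map μ.1.rowLen := by
    rw [Fin.univ_val_map, ← Multiset.coe_range, Multiset.map_coe, List.ofFn_eq_map,
      ← List.map_coe_finRange_eq_range, List.map_map]
    rfl
  rw [h1, Multiset.filter_map, YoungDiagram.rowLens, ← Multiset.map_coe]
  congr 1
  have h2 : (Multiset.range k).filter ((· ≠ 0) ∘ μ.1.rowLen) =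
      ((Finset.range k).filter fun i => μ.1.rowLen i ≠ 0).val := rfl
  have h3 : ((Finset.range k).filter fun i => μ.1.rowLen i ≠ 0) =
      Finset.range (μ.1.colLen 0) := by
    ext i
    rw [Finset.mem_filter, Finset.mem_range, Finset.mem_range, ← Nat.pos_iff_ne_zero,
      ← YoungDiagram.mem_iff_lt_rowLen, YoungDiagram.mem_iff_lt_colLen]
    exact ⟨fun h => h.2, fun h => ⟨h.trans_le μ.2.1, h⟩⟩
  rw [h2, h3]
  rfl

theorem coeff_mPoly (μ : YoungDiagram) (d : Fin k →₀ ℕ) :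
    coeff d (mPoly k R μ : MvPolynomial (Fin k) R) =
      if expParts d = μ.rowLens then 1 else 0 := by
  have hmon : ∀ s : Multiset (Fin k), (s.map X).prod =
      (monomial (Multiset.toFinsupp s) (1 : R) : MvPolynomial (Fin k) R) := fun s => by
    induction s using Multiset.induction_on with
    | empty => simp
    | cons a s ih =>
      rw [Multiset.map_cons, Multiset.prod_cons, ih, X, monomial_mul, ← Multiset.singleton_add,
        map_add, Multiset.toFinsupp_singleton, one_mul]
  have hparts : ∀ s : Sym (Fin k) (μ.rowLens : Multiset ℕ).sum,
      Nat.Partition.ofSym s = parts μ ↔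
        expParts (Multiset.toFinsupp (s : Multiset (Fin k))) = μ.rowLens := fun s => by
    rw [Nat.Partition.ext_iff]
    have h1 : (parts μ).parts = μ.rowLens := by
      rw [parts, Nat.Partition.ofMultiset_parts, Multiset.filter_eq_self]
      exact fun x hx => (μ.pos_of_mem_rowLens x hx).ne'
    rw [h1]
    have h2 : (Nat.Partition.ofSym s).parts =
        expParts (Multiset.toFinsupp (s : Multiset (Fin k))) := by
      simp only [Nat.Partition.ofSym, expParts, Multiset.toFinsupp_support]
      rw [Multiset.toFinset_val]
      rfl
    rw [h2]
  have h0 : (mPoly k R μ : MvPolynomial (Fin k) R) =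
      ∑ s : {a : Sym (Fin k) _ // Nat.Partition.ofSym a = parts μ},
        monomial (Multiset.toFinsupp (s.1 : Multiset (Fin k))) (1 : R) :=
    Finset.sum_congr rfl fun s _ => hmon _
  rw [h0, coeff_sum]
  simp only [coeff_monomial]
  split_ifs with h
  · have hcard : Multiset.card (Finsupp.toMultiset d) = (μ.rowLens : Multiset ℕ).sum := by
      rw [← h, Finsupp.card_toMultiset]
      rfl
    let s : Sym (Fin k) (μ.rowLens : Multiset ℕ).sum := ⟨Finsupp.toMultiset d, hcard⟩
    have hs : Multiset.toFinsupp (s : Multiset (Fin k)) = d := Finsupp.toMultiset_toFinsupp d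
    rw [Finset.sum_eq_single ⟨s, (hparts s).2 (by rw [hs, h])⟩]
    · rw [if_pos hs]
    · rintro ⟨t, ht⟩ - hne
      refine if_neg fun h' => hne (Subtype.ext (Subtype.ext ?_))
      exact Multiset.toFinsupp.injective (h'.trans hs.symm)
    · exact fun h' => absurd (Finset.mem_univ _) h'
  · refine Finset.sum_eq_zero fun s _ => if_neg fun h' => h ?_
    rw [← h']
    exact (hparts s.1).1 s.2

theorem coeff_perm (f : SymRing k R) (σ : Equiv.Perm (Fin k)) (d : Fin k →₀ ℕ) :
    coeff (d.mapDomain σ) (f : MvPolynomial (Fin k) R) = coeff d (f : MvPolynomial (Fin k) R) := by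
  conv_lhs => rw [← f.2 σ]
  exact coeff_rename_mapDomain _ σ.injective _ _

/-- A symmetric polynomial has constant coefficients on orbits of exponents, and each orbit inside
the bound contains exactly one partition in the box. -/
theorem expLE_le_span_mPoly :
    symSupp k R (expLE k m) ≤
      Submodule.span R (Set.range fun μ : Box k m => mPoly k R μ.1) := by
  intro f hf
  have := Fintype.ofFinite (Box k m)
  let lam : Box k m → Fin k →₀ ℕ := fun μ => Finsupp.equivFunOnFinite.symm fun i => μ.1.rowLen i
  have key : f = ∑ μ : Box k m, coeff (lam μ) (f : MvPolynomial (Fin k) R) • mPoly k R μ.1 := by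
    refine Subtype.ext (MvPolynomial.ext _ _ fun d => ?_)
    rw [AddSubmonoidClass.coe_finsetSum, coeff_sum]
    have hterm : ∀ μ : Box k m, coeff d ((coeff (lam μ) (f : MvPolynomial (Fin k) R) •
        mPoly k R μ.1 : SymRing k R) : MvPolynomial (Fin k) R) =
        if expParts d = μ.1.rowLens then coeff (lam μ) (f : MvPolynomial (Fin k) R) else 0 :=
      fun μ => by
        have h1 : ((coeff (lam μ) (f : MvPolynomial (Fin k) R) • mPoly k R μ.1 : SymRing k R) :
            MvPolynomial (Fin k) R) =
          coeff (lam μ) (f : MvPolynomial (Fin k) R) • (mPoly k R μ.1).1 := rfl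
        rw [h1, coeff_smul, coeff_mPoly, smul_eq_mul, mul_ite, mul_one, mul_zero]
    simp only [hterm]
    by_cases hd : d ∈ expLE k m
    · obtain ⟨σ, hσ⟩ := exists_perm_antitone d
      obtain ⟨μ, hμ⟩ := exists_box (m := m) (d ∘ σ) hσ fun i => hd (σ i)
      have hlam : d = (lam μ).mapDomain σ := by
        ext i
        rw [Finsupp.mapDomain_equiv_apply]
        simp [lam, hμ]
      have hparts : expParts d = μ.1.rowLens := by
        rw [expParts_eq, rowLens_eq]
        congr 1
        have : (fun i : Fin k => μ.1.rowLen i) = d ∘ σ := funext hμ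
        rw [this, ← Multiset.map_map]
        congr 1
        simp
      rw [Finset.sum_eq_single μ, if_pos hparts, hlam, coeff_perm]
      · intro ν _ hν
        refine if_neg fun h => hν ?_
        have h2 : (ν.1.rowLens : Multiset ℕ) = μ.1.rowLens := h.symm.trans hparts
        have h3 : ν.1.rowLens = μ.1.rowLens :=
          (Multiset.coe_eq_coe.1 h2).eq_of_sortedGE ν.1.rowLens_sorted μ.1.rowLens_sorted
        exact Subtype.ext (YoungDiagram.equivListRowLens.injective (Subtype.ext h3))
      · simp
    · have h1 : coeff d (f : MvPolynomial (Fin k) R) = 0 := by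
        by_contra h; exact hd (hf d h)
      rw [h1]
      refine (Finset.sum_eq_zero fun μ _ => if_neg fun h => hd fun i => ?_).symm
      by_cases hi : d i = 0
      · rw [hi]; exact Nat.zero_le _
      have h2 : d i ∈ expParts d := Multiset.mem_map.2 ⟨i, by simpa using hi, rfl⟩
      rw [h, rowLens_eq, Multiset.mem_filter, Multiset.mem_map] at h2
      obtain ⟨⟨j, -, hj⟩, -⟩ := h2
      rw [← hj]
      exact μ.rowLen_le _
  rw [key]
  exact Submodule.sum_mem _ fun μ _ => Submodule.smul_mem _ _ (Submodule.subset_span ⟨μ, rfl⟩)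

end Monomial

end Families

/-! ### Schur polynomials and quotients of alternants -/

section Alternants

variable {k m : ℕ} {R : Type*} [CommRing R]

section Schur

/-- The elementary symmetric polynomial `e_i`. -/
def eS (k : ℕ) (R : Type*) [CommRing R] (i : ℕ) : SymRing k R :=
  ⟨esymm (Fin k) R i, esymm_isSymmetric _ _ i⟩

/-- The polynomial `∏ (T - x_i)` with coefficients in the ring of symmetric polynomials. -/
def charPoly (k : ℕ) (R : Type*) [CommRing R] : Polynomial (SymRing k R) :=
  ∑ j ∈ Finset.range (k + 1),
    Polynomial.C ((-1) ^ j * eS k R j) * Polynomial.X ^ (k - j)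

/-- The inclusion of the ring of symmetric polynomials. -/
def symVal (k : ℕ) (R : Type*) [CommRing R] : SymRing k R →+* MvPolynomial (Fin k) R :=
  (symmetricSubalgebra (Fin k) R).val

theorem symVal_apply (f : SymRing k R) : symVal k R f = f.1 := rfl

theorem symVal_injective : Function.Injective (symVal k R) := Subtype.val_injective

theorem map_charPoly : (charPoly k R).map (symVal k R) =
    ∏ i : Fin k, (Polynomial.X - Polynomial.C (X i)) := by
  have h := Multiset.prod_X_sub_X_eq_sum_esymm
    ((Finset.univ : Finset (Fin k)).val.map (X : Fin k → MvPolynomial (Fin k) R))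
  rw [Multiset.map_map] at h
  rw [Finset.prod_eq_multiset_prod]
  refine Eq.trans ?_ h.symm
  rw [charPoly, Polynomial.map_sum, Multiset.card_map, Finset.card_val, Finset.card_univ,
    Fintype.card_fin]
  refine Finset.sum_congr rfl fun j _ => ?_
  rw [← esymm_eq_multiset_esymm]
  simp [symVal_apply, eS, mul_assoc]

theorem charPoly_monic : (charPoly k R).Monic := by
  refine Polynomial.monic_of_injective symVal_injective ?_
  rw [map_charPoly]
  exact Polynomial.monic_prod_of_monic _ _ fun j _ => Polynomial.monic_X_sub_C _

theorem natDegree_charPoly [Nontrivial R] : (charPoly k R).natDegree = k := by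
  rw [← Polynomial.natDegree_map_eq_of_injective symVal_injective, map_charPoly,
    Polynomial.natDegree_prod_of_monic _ _ fun j _ => Polynomial.monic_X_sub_C _]
  simp

/-- The coefficients of the remainders of `T ^ (α i)` modulo `∏ (T - x_j)`. -/
def remMatrix (R : Type*) [CommRing R] (α : Fin k → ℕ) : Matrix (Fin k) (Fin k) (SymRing k R) :=
  Matrix.of fun i l => ((Polynomial.X ^ α i : Polynomial (SymRing k R)) %ₘ charPoly k R).coeff l

/-- The quotient of an alternant by the Vandermonde determinant. -/
def genSchur (R : Type*) [CommRing R] (α : Fin k → ℕ) : SymRing k R := (remMatrix R α).det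

/-- The Vandermonde determinant. -/
def vdm (k : ℕ) (R : Type*) [CommRing R] : MvPolynomial (Fin k) R :=
  (Matrix.vandermonde (X : Fin k → MvPolynomial (Fin k) R)).det

/-- Each `x_j` is a root of `charPoly`, so `x_j ^ α i` is the value at `x_j` of the remainder of `T
^ α i`; this factors the alternant matrix. Defining the quotient through remainders makes it visibly
symmetric and compatible with ring homomorphisms. -/
theorem genSchur_mul_vdm (α : Fin k → ℕ) :
    (genSchur R α : MvPolynomial (Fin k) R) * vdm k R = alternant R α := by
  rcases subsingleton_or_nontrivial R with h | h
  · exact Subsingleton.elim _ _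
  have hM : (Matrix.of fun i j : Fin k => (X j : MvPolynomial (Fin k) R) ^ α i) =
      (symVal k R).mapMatrix (remMatrix R α) *
        (Matrix.vandermonde (X : Fin k → MvPolynomial (Fin k) R)).transpose := by
    ext1 i j
    set r := (Polynomial.X ^ α i : Polynomial (SymRing k R)) %ₘ charPoly k R with hr
    have hroot : (charPoly k R).eval₂ (symVal k R) (X j) = 0 := by
      rw [← Polynomial.eval_map, map_charPoly, Polynomial.eval_prod]
      exact Finset.prod_eq_zero (Finset.mem_univ j) (by simp)
    have h1 : r.eval₂ (symVal k R) (X j) = X j ^ α i := by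
      have := congrArg (Polynomial.eval₂ (symVal k R) (X j))
        (Polynomial.modByMonic_add_div (Polynomial.X ^ α i : Polynomial (SymRing k R))
          (charPoly k R))
      simpa [Polynomial.eval₂_add, Polynomial.eval₂_mul, hroot] using this
    have hlt : r.natDegree < k ∨ r = 0 := by
      by_cases h0 : r = 0
      · exact Or.inr h0
      · left
        have := Polynomial.degree_modByMonic_lt
          (Polynomial.X ^ α i : Polynomial (SymRing k R)) (charPoly_monic (k := k) (R := R))
        rw [← hr, Polynomial.degree_eq_natDegree h0,
          Polynomial.degree_eq_natDegree charPoly_monic.ne_zero, natDegree_charPoly] at this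
        exact_mod_cast this
    have h2 : r.eval₂ (symVal k R) (X j) =
        ∑ l ∈ Finset.range k, symVal k R (r.coeff l) * X j ^ l := by
      rcases hlt with hlt | h0
      · exact Polynomial.eval₂_eq_sum_range' _ hlt _
      · simp [h0]
    rw [Matrix.of_apply, ← h1, h2, Matrix.mul_apply, Finset.sum_range]
    rfl
  rw [alternant, hM, Matrix.det_mul, Matrix.det_transpose, ← RingHom.map_det]
  rfl

theorem mul_vdm_cancel {f g : MvPolynomial (Fin k) R} (h : f * vdm k R = g * vdm k R) : f = g :=
  (mul_cancel_right_mem_nonZeroDivisors (vandermonde_mem_nonZeroDivisors k R)).1 h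

theorem alternant_eq_sum (e : Fin k →₀ ℕ) :
    alternant R e = ∑ σ : Equiv.Perm (Fin k),
      Equiv.Perm.sign σ • rename σ (monomial e (1 : R)) := by
  rw [alternant, ← Matrix.det_transpose, Matrix.det_apply]
  refine Finset.sum_congr rfl fun σ _ => ?_
  congr 1
  rw [monomial_eq, map_one, one_mul, Finsupp.prod_fintype _ _ fun _ => pow_zero _, map_prod]
  simp

theorem vdm_eq_alternant : vdm k R = alternant R (fun i : Fin k => (i : ℕ)) := by
  rw [vdm, alternant, ← Matrix.det_transpose]
  rfl

/-- A symmetric polynomial as a combination of quotients of alternants. -/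
theorem eq_sum_genSchur (f : SymRing k R) :
    f = ∑ β ∈ (f : MvPolynomial (Fin k) R).support,
      coeff β (f : MvPolynomial (Fin k) R) • genSchur R fun i => β i + i := by
  refine Subtype.ext (mul_vdm_cancel ?_)
  let δ : Fin k →₀ ℕ := Finsupp.equivFunOnFinite.symm fun i => (i : ℕ)
  have h1 : ((∑ β ∈ (f : MvPolynomial (Fin k) R).support,
      coeff β (f : MvPolynomial (Fin k) R) • genSchur R fun i => β i + i : SymRing k R) :
        MvPolynomial (Fin k) R) * vdm k R =
      ∑ β ∈ (f : MvPolynomial (Fin k) R).support,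
        coeff β (f : MvPolynomial (Fin k) R) • alternant R (β + δ) := by
    rw [AddSubmonoidClass.coe_finsetSum, Finset.sum_mul]
    refine Finset.sum_congr rfl fun β _ => ?_
    have h2 : ((coeff β (f : MvPolynomial (Fin k) R) • genSchur R fun i => β i + i :
      SymRing k R) : MvPolynomial (Fin k) R) =
        coeff β (f : MvPolynomial (Fin k) R) • (genSchur R fun i => β i + i).1 := rfl
    rw [h2, smul_mul_assoc, genSchur_mul_vdm]
    rfl
  rw [h1]
  have h3 : vdm k R = ∑ σ : Equiv.Perm (Fin k),
      Equiv.Perm.sign σ • rename σ (monomial δ (1 : R)) := by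
    rw [vdm_eq_alternant, ← alternant_eq_sum]
    rfl
  simp only [h3, Finset.mul_sum, alternant_eq_sum, Finset.smul_sum]
  rw [Finset.sum_comm]
  refine Finset.sum_congr rfl fun σ _ => ?_
  -- By symmetry, `f` can be moved inside each term of the alternating sum for the Vandermonde
  -- determinant and expanded into monomials there.
  have h4 : (f : MvPolynomial (Fin k) R) = rename σ (f : MvPolynomial (Fin k) R) := (f.2 σ).symm
  rw [mul_smul_comm]
  conv_lhs => rw [h4]
  rw [← map_mul]
  conv_lhs => rw [(f : MvPolynomial (Fin k) R).as_sum]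
  rw [Finset.sum_mul, map_sum, Finset.smul_sum]
  refine Finset.sum_congr rfl fun β _ => ?_
  have h5 : monomial β (coeff β (f : MvPolynomial (Fin k) R)) * monomial δ 1 =
      coeff β (f : MvPolynomial (Fin k) R) • monomial (β + δ) (1 : R) := by
    rw [monomial_mul, smul_monomial, smul_eq_mul]
  rw [h5, map_smul (rename σ), smul_comm]

theorem genSchur_perm (α : Fin k → ℕ) (σ : Equiv.Perm (Fin k)) :
    genSchur R (α ∘ σ) = Equiv.Perm.sign σ * genSchur R α := by
  rw [genSchur, genSchur, ← Matrix.det_permute]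
  rfl

theorem genSchur_eq_zero {α : Fin k → ℕ} (h : ¬ Function.Injective α) : genSchur R α = 0 := by
  simp only [Function.Injective] at h
  push Not at h
  obtain ⟨i, j, hij, hne⟩ := h
  refine Matrix.det_zero_of_row_eq hne ?_
  funext l
  simp [remMatrix, hij]

theorem genSchur_rowLen (μ : Box k m) :
    ∃ u : ℤˣ, genSchur R (fun i => μ.1.rowLen i + stair k i) = u • sPoly k R μ.1 := by
  obtain ⟨u, hu⟩ := alternant_stair k R
  refine ⟨u, Subtype.ext (mul_vdm_cancel ?_)⟩
  have h1 := schurQuotient_mul k R μ.1 μ.2.1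
  rw [hu] at h1
  rw [genSchur_mul_vdm, ← h1]
  have : ((u • sPoly k R μ.1 : SymRing k R) : MvPolynomial (Fin k) R) =
    u • schurQuotient k R μ.1 := rfl
  rw [this, mul_smul_comm, smul_mul_assoc]
  rfl

theorem strictAnti_add_le {f : Fin k → ℕ} (hf : StrictAnti f) (n : ℕ) (i j : Fin k)
    (h : (i : ℕ) + n = j) : f j + n ≤ f i := by
  induction n generalizing j with
  | zero => rw [Fin.ext (by simpa using h) (a := i)]; simp
  | succ n ih =>
    have h1 := ih ⟨i + n, by omega⟩ rfl
    have h2 : f j < f ⟨i + n, by omega⟩ := hf (Fin.lt_def.2 (by simp; omega))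
    omega

/-- A repeated exponent gives zero. Distinct exponents can be sorted decreasingly at the cost of a
sign, and subtracting the staircase leaves a partition in the box. -/
theorem genSchur_mem_span (α : Fin k → ℕ) (hα : ∀ i, α i < k + m) :
    genSchur R α ∈ Submodule.span R (Set.range fun μ : Box k m => sPoly k R μ.1) := by
  by_cases hinj : Function.Injective α
  swap
  · rw [genSchur_eq_zero hinj]; exact Submodule.zero_mem _
  obtain ⟨σ, hσ⟩ := exists_perm_antitone α
  have hanti : StrictAnti (α ∘ σ) := hσ.strictAnti_of_injective (hinj.comp σ.injective)
  have hle : ∀ i : Fin k, k - 1 - (i : ℕ) ≤ α (σ i) := fun i => by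
    have := i.2
    have := strictAnti_add_le hanti (k - 1 - i) i ⟨k - 1, by omega⟩ (by simp; omega)
    simp only [Function.comp] at this
    omega
  obtain ⟨μ, hμ⟩ := exists_box (m := m) (fun i : Fin k => α (σ i) - (k - 1 - i))
    (fun i j hij => by
      have := strictAnti_add_le hanti (j - i) i j (by have := Fin.le_def.1 hij; omega)
      simp only [Function.comp] at this
      have := Fin.le_def.1 hij
      have := j.2
      dsimp only
      omega)
    (fun i => by
      have hi := i.2
      have h1 := strictAnti_add_le hanti i ⟨0, by omega⟩ i (by simp)
      have h2 := hα (σ ⟨0, by omega⟩)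
      simp only [Function.comp] at h1
      omega)
  obtain ⟨u, hu⟩ := genSchur_rowLen (R := R) μ
  have h1 : (fun i : Fin k => μ.1.rowLen i + stair k i) = α ∘ σ := by
    funext i
    rw [hμ, stair, Function.comp, Nat.sub_add_cancel (hle i)]
  rw [h1, genSchur_perm] at hu
  have h2 : sPoly k R μ.1 ∈ Submodule.span R (Set.range fun μ : Box k m => sPoly k R μ.1) :=
    Submodule.subset_span ⟨μ, rfl⟩
  have h3 : (Equiv.Perm.sign σ : SymRing k R) * genSchur R α ∈
      Submodule.span R (Set.range fun μ : Box k m => sPoly k R μ.1) := by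
    rw [hu]
    rcases Int.units_eq_one_or u with rfl | rfl
    · simpa using h2
    · simpa using h2
  rcases Int.units_eq_one_or (Equiv.Perm.sign σ) with h | h <;> rw [h] at h3
  · simpa using h3
  · have h4 := neg_mem h3
    have h5 : -(((-1 : ℤˣ) : SymRing k R) * genSchur R α) = genSchur R α :=
      Subtype.ext (by simp)
    rwa [h5] at h4

theorem expLE_le_span_sPoly :
    symSupp k R (expLE k m) ≤
      Submodule.span R (Set.range fun μ : Box k m => sPoly k R μ.1) := by
  intro f hf
  rw [eq_sum_genSchur f]
  refine Submodule.sum_mem _ fun β hβ => Submodule.smul_mem _ _ (genSchur_mem_span _ fun i => ?_)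
  have := hf β (mem_support_iff.1 hβ) i
  have := i.2
  omega

theorem degreeOf_perm (f : SymRing k R) (i j : Fin k) :
    degreeOf i (f : MvPolynomial (Fin k) R) = degreeOf j (f : MvPolynomial (Fin k) R) := by
  have h := degreeOf_rename_of_injective (p := (f : MvPolynomial (Fin k) R))
    (Equiv.swap i j).injective i
  rw [f.2 (Equiv.swap i j), Equiv.swap_apply_left] at h
  exact h.symm

/-- As a polynomial in `x_0`, the Vandermonde determinant is, up to sign, a monic polynomial of
degree `k` times the Vandermonde determinant of the other variables, which is not a zero divisor.
Hence the degrees add over every nontrivial ring. -/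
theorem degreeOf_zero_le_of_mul_vdm {f : MvPolynomial (Fin (k + 1)) R}
    (h : degreeOf 0 (f * vdm (k + 1) R) ≤ k + m) : degreeOf 0 f ≤ m := by
  rcases subsingleton_or_nontrivial R with hR | hR
  · rw [Subsingleton.elim f 0]; simp
  let V' : MvPolynomial (Fin k) R := vdm k R
  let Q : Polynomial (MvPolynomial (Fin k) R) := ∏ j : Fin k, (Polynomial.X - Polynomial.C (X j))
  have hQ : Q.Monic := Polynomial.monic_prod_of_monic _ _ fun j _ => Polynomial.monic_X_sub_C _
  have hQd : Q.natDegree = k := by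
    rw [Polynomial.natDegree_prod_of_monic _ _ fun j _ => Polynomial.monic_X_sub_C _]
    simp
  have hV : finSuccEquiv R k (vdm (k + 1) R) = (-1) ^ k * Q * Polynomial.C V' := by
    have h1 : (-1) ^ k * Q = ∏ j : Fin k, (Polynomial.C (X j) - Polynomial.X) := by
      have : ((-1 : Polynomial (MvPolynomial (Fin k) R))) ^ k = ∏ _j : Fin k, -1 := by simp
      rw [this, ← Finset.prod_mul_distrib]
      exact Finset.prod_congr rfl fun j _ => by ring
    rw [h1]
    simp only [V', vdm, Matrix.det_vandermonde, map_prod, map_sub]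
    rw [Fin.prod_univ_succ, Fin.prod_Ioi_zero]
    congr 1
    · simp [finSuccEquiv_X_zero, finSuccEquiv_X_succ]
    · refine Finset.prod_congr rfl fun i _ => ?_
      rw [Fin.prod_Ioi_succ]
      simp [finSuccEquiv_X_succ]
  by_cases hf : f = 0
  · simp [hf]
  set F := finSuccEquiv R k f with hF
  have hF0 : F ≠ 0 := by simpa [hF] using hf
  have hFQ0 : (F * Q) ≠ 0 := fun h => hF0 (by
    have := hQ.mul_left_eq_zero_iff.1 h
    exact this)
  rw [← natDegree_finSuccEquiv, map_mul, hV, ← hF] at h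
  rw [← natDegree_finSuccEquiv, ← hF]
  have h2 : F * ((-1) ^ k * Q * Polynomial.C V') = (-1) ^ k * (F * Q * Polynomial.C V') := by ring
  have h3 : ((-1) ^ k * (F * Q * Polynomial.C V')).natDegree =
      (F * Q * Polynomial.C V').natDegree := by
    rcases neg_one_pow_eq_or (Polynomial (MvPolynomial (Fin k) R)) k with h | h <;> simp [h]
  have h4 : (F * Q * Polynomial.C V').natDegree = (F * Q).natDegree := by
    refine Polynomial.natDegree_mul_C_eq_of_mul_ne_zero fun h0 => ?_
    have := (mem_nonZeroDivisors_iff_right.1 (vandermonde_mem_nonZeroDivisors k R)) _ h0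
    exact hFQ0 (Polynomial.leadingCoeff_eq_zero.1 this)
  rw [h2, h3, h4, mul_comm F Q, hQ.natDegree_mul' hF0, hQd] at h
  omega

theorem degreeOf_alternant_le {α : Fin k → ℕ} {N : ℕ} (hα : ∀ i, α i ≤ N) (j : Fin k) :
    degreeOf j (alternant R α) ≤ N := by
  rcases subsingleton_or_nontrivial R with hR | hR
  · rw [Subsingleton.elim (alternant R α) 0]; simp
  rw [alternant, Matrix.det_apply']
  refine (degreeOf_sum_le _ _ _).trans (Finset.sup_le fun σ _ => ?_)
  refine (degreeOf_mul_le _ _ _).trans ?_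
  have h1 : degreeOf j (((Equiv.Perm.sign σ : ℤ) : MvPolynomial (Fin k) R)) = 0 := by
    rw [← map_intCast (C : R →+* MvPolynomial (Fin k) R), degreeOf_C]
  rw [h1, zero_add]
  refine (degreeOf_prod_le _ _ _).trans ?_
  rw [Finset.sum_eq_single j]
  · exact (degreeOf_pow_le _ _ _).trans (by simpa using hα (σ j))
  · intro i _ hi
    refine Nat.eq_zero_of_le_zero ((degreeOf_pow_le _ _ _).trans ?_)
    rw [degreeOf_X, if_neg hi.symm, mul_zero]
  · simp

/-- Each variable has degree at most `k + m - 1` in the alternant and the Vandermonde determinant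
accounts for `k - 1` of it; by symmetry one variable suffices. -/
theorem genSchur_mem_expLE {α : Fin k → ℕ} (hα : ∀ i, α i < k + m) :
    genSchur R α ∈ symSupp k R (expLE k m) := by
  rw [mem_symSupp_expLE]
  intro i
  rcases k with _ | k
  · exact i.elim0
  rw [degreeOf_perm _ i 0]
  refine degreeOf_zero_le_of_mul_vdm ?_
  rw [genSchur_mul_vdm]
  exact degreeOf_alternant_le (fun i => by have := hα i; omega) 0

end Schur

end Alternants

section Generation

variable {k m : ℕ} {R : Type*} [CommRing R]

/-! ### Reduction modulo complete homogeneous polynomials -/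

section Complete

/-- The polynomial `∏ (1 - x_i T)` with coefficients in the ring of symmetric polynomials. -/
def ePol (k : ℕ) (R : Type*) [CommRing R] : Polynomial (SymRing k R) :=
  ∑ j ∈ Finset.range (k + 1), Polynomial.C ((-1) ^ j * eS k R j) * Polynomial.X ^ j

theorem natDegree_ePol_le : (ePol k R).natDegree ≤ k := by
  refine Polynomial.natDegree_sum_le_of_forall_le _ _ fun j hj => ?_
  refine (Polynomial.natDegree_C_mul_X_pow_le _ _).trans ?_
  have := Finset.mem_range.1 hj
  omega

theorem reflect_ePol : (ePol k R).reflect k = charPoly k R := by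
  have h : ∀ (s : Finset ℕ) (f : ℕ → Polynomial (SymRing k R)),
      (∑ j ∈ s, f j).reflect k = ∑ j ∈ s, (f j).reflect k := fun s f => by
    induction s using Finset.induction_on with
    | empty => simp
    | insert a s ha ih => rw [Finset.sum_insert ha, Finset.sum_insert ha,
        Polynomial.reflect_add, ih]
  rw [ePol, h, charPoly]
  refine Finset.sum_congr rfl fun j hj => ?_
  rw [Polynomial.reflect_C_mul_X_pow, Polynomial.revAt_le (Nat.lt_succ_iff.1 (Finset.mem_range.1 hj))]

theorem prod_one_sub_C_mul_X {A : Type*} [CommRing A] (x : Fin k → A) :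
    ∏ i, (1 - Polynomial.C (x i) * Polynomial.X) =
      ∑ j ∈ Finset.range (k + 1), Polynomial.C ((-1) ^ j *
        ∑ t ∈ Finset.powersetCard j Finset.univ, ∏ i ∈ t, x i) * Polynomial.X ^ j := by
  have h0 : ∀ i, 1 - Polynomial.C (x i) * Polynomial.X =
      1 + Polynomial.C (-x i) * Polynomial.X := fun i => by
    rw [map_neg, neg_mul, sub_eq_add_neg]
  simp only [h0]
  rw [Finset.prod_one_add, Finset.sum_powerset, Finset.card_univ, Fintype.card_fin]
  refine Finset.sum_congr rfl fun j _ => ?_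
  rw [Finset.mul_sum, map_sum, Finset.sum_mul]
  refine Finset.sum_congr rfl fun t ht => ?_
  rw [Finset.prod_mul_distrib, Finset.prod_const, (Finset.mem_powersetCard.1 ht).2, ← map_prod,
    Finset.prod_neg, (Finset.mem_powersetCard.1 ht).2]

theorem map_ePol : (ePol k R).map (symVal k R) =
    ∏ i : Fin k, (1 - Polynomial.C (X i) * Polynomial.X) := by
  rw [prod_one_sub_C_mul_X, ePol, Polynomial.map_sum]
  refine Finset.sum_congr rfl fun j _ => ?_
  rw [Polynomial.map_mul, Polynomial.map_pow, Polynomial.map_X, Polynomial.map_C, map_mul, map_pow,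
    map_neg, map_one]
  rfl

theorem hsymm_eq_sum_monomial (d : ℕ) :
    hsymm (Fin k) R d = ∑ l ∈ Finset.finsuppAntidiag Finset.univ d, monomial l 1 := by
  rw [hsymm]
  refine Finset.sum_bij (fun s _ => Multiset.toFinsupp (s : Multiset (Fin k))) ?_ ?_ ?_ ?_
  · intro s _
    rw [Finset.mem_finsuppAntidiag]
    refine ⟨?_, Finset.subset_univ _⟩
    exact (Multiset.sum_count_eq_card fun _ _ => Finset.mem_univ _).trans s.2
  · intro s _ t _ h
    exact Subtype.ext (Multiset.toFinsupp.injective h)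
  · intro l hl
    rw [Finset.mem_finsuppAntidiag] at hl
    refine ⟨⟨Finsupp.toMultiset l, ?_⟩, Finset.mem_univ _, Finsupp.toMultiset_toFinsupp l⟩
    rw [Finsupp.card_toMultiset, Finsupp.sum_fintype _ _ fun _ => rfl]
    exact hl.1
  · intro s _
    show (Multiset.map X (s : Multiset (Fin k))).prod = _
    generalize (s : Multiset (Fin k)) = t
    induction t using Multiset.induction_on with
    | empty => simp
    | cons a t ih =>
      rw [Multiset.map_cons, Multiset.prod_cons, ih, X, monomial_mul, ← Multiset.singleton_add,
        map_add, Multiset.toFinsupp_singleton, one_mul]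

theorem mk_hPoly : (PowerSeries.mk fun d => (hPoly k R d)).map (symVal k R) =
    ∏ i : Fin k, PowerSeries.mk fun d => (X i : MvPolynomial (Fin k) R) ^ d := by
  ext1 d
  rw [PowerSeries.coeff_map, PowerSeries.coeff_mk, PowerSeries.coeff_prod]
  refine (hsymm_eq_sum_monomial d).trans (Finset.sum_congr rfl fun l _ => ?_)
  rw [monomial_eq, map_one, one_mul, Finsupp.prod_fintype _ _ fun _ => pow_zero _]
  simp

/-- The relation `E(-T) H(T) = 1`. -/
theorem ePol_mul_mk_hPoly :
    (ePol k R : PowerSeries (SymRing k R)) * PowerSeries.mk (fun d => hPoly k R d) = 1 := by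
  have hinj : Function.Injective (PowerSeries.map (symVal k R)) := fun f g h => by
    ext1 d
    have := congrArg (PowerSeries.coeff d) h
    rw [PowerSeries.coeff_map, PowerSeries.coeff_map] at this
    exact symVal_injective this
  apply hinj
  rw [map_mul, map_one, mk_hPoly, ← Polynomial.polynomial_map_coe, map_ePol]
  have h : ((∏ i : Fin k, (1 - Polynomial.C (X i) * Polynomial.X) :
      Polynomial (MvPolynomial (Fin k) R)) : PowerSeries (MvPolynomial (Fin k) R)) =
      ∏ i : Fin k, (1 - PowerSeries.C (X i) * PowerSeries.X) := by
    rw [← Polynomial.coeToPowerSeries.ringHom_apply, map_prod]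
    simp
  rw [h, ← Finset.prod_mul_distrib]
  refine Finset.prod_eq_one fun i _ => ?_
  ext1 d
  rw [sub_mul, one_mul, map_sub, mul_assoc, PowerSeries.coeff_C_mul]
  rcases d with _ | d
  · simp
  · rw [PowerSeries.coeff_succ_X_mul]
    simp [PowerSeries.coeff_one, pow_succ']

/-- The ideal generated by `h_{m+1}, …, h_{m+k}`. -/
def hIdeal (k m : ℕ) (R : Type*) [CommRing R] : Ideal (SymRing k R) :=
  Ideal.span (Set.range fun i : Fin k => hPoly k R (m + (i + 1)))

theorem coeff_ePol_of_lt {i : ℕ} (h : k < i) : (ePol k R).coeff i = 0 :=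
  Polynomial.coeff_eq_zero_of_natDegree_lt (natDegree_ePol_le.trans_lt h)

/-- Beyond the generators, `E(-T) H(T) = 1` expresses `h_d` through the `k` preceding ones, all of
index above `m`. -/
theorem hPoly_mem_hIdeal {d : ℕ} (hd : m < d) : hPoly k R d ∈ hIdeal k m R := by
  induction d using Nat.strong_induction_on with
  | _ d ih =>
  by_cases hdk : d ≤ m + k
  · refine Ideal.subset_span ⟨⟨d - m - 1, by omega⟩, ?_⟩
    show hPoly k R (m + (d - m - 1 + 1)) = _
    congr 1
    omega
  · have h1 := congrArg (PowerSeries.coeff d) (ePol_mul_mk_hPoly (k := k) (R := R))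
    rw [PowerSeries.coeff_mul, PowerSeries.coeff_one, if_neg (by omega),
      ← Finset.add_sum_erase _ _ (a := (0, d)) (by simp)] at h1
    have h0 : (ePol k R).coeff 0 = 1 := by
      refine Subtype.ext ?_
      simp [ePol, Polynomial.coeff_X_pow, eS]
    simp only [Polynomial.coeff_coe, PowerSeries.coeff_mk, h0, one_mul] at h1
    rw [eq_neg_of_add_eq_zero_left h1]
    refine neg_mem (Ideal.sum_mem _ fun p hp => ?_)
    rw [Finset.mem_erase, Finset.HasAntidiagonal.mem_antidiagonal] at hp
    by_cases hk : k < p.1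
    · rw [coeff_ePol_of_lt hk, zero_mul]; exact Ideal.zero_mem _
    · have hp1 : p.1 ≠ 0 := fun h => hp.1 (Prod.ext h (by have := hp.2; simp only; omega))
      exact Ideal.mul_mem_left _ _ (ih p.2 (by have := hp.2; omega) (by have := hp.2; omega))

/-- Once the `h_d` with `d > m` vanish, `H` is a polynomial of degree at most `m`. Reversing the
coefficients in `E(-T) H(T) = 1` shows that `charPoly` divides `T ^ (k + m)`, so an exponent of at
least `k + m` gives a zero row of remainders. -/
theorem map_genSchur_eq_zero {B : Type*} [CommRing B] (q : SymRing k R →+* B)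
    (hq : ∀ d, m < d → q (hPoly k R d) = 0) {α : Fin k → ℕ} {i : Fin k} (hα : k + m ≤ α i) :
    q (genSchur R α) = 0 := by
  let H : Polynomial B :=
    ∑ j ∈ Finset.range (m + 1), Polynomial.C (q (hPoly k R j)) * Polynomial.X ^ j
  have hHd : H.natDegree ≤ m := by
    refine Polynomial.natDegree_sum_le_of_forall_le _ _ fun j hj => ?_
    refine (Polynomial.natDegree_C_mul_X_pow_le _ _).trans ?_
    have := Finset.mem_range.1 hj
    omega
  have hH : (H : PowerSeries _) = (PowerSeries.mk fun d => hPoly k R d).map q := by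
    ext1 d
    rw [Polynomial.coeff_coe, PowerSeries.coeff_map, PowerSeries.coeff_mk]
    simp only [H, Polynomial.finsetSum_coeff, Polynomial.coeff_C_mul, Polynomial.coeff_X_pow,
      mul_ite, mul_one, mul_zero, Finset.sum_ite_eq, Finset.mem_range]
    split_ifs with h
    · rfl
    · exact (hq d (by omega)).symm
  have hEH : (ePol k R).map q * H = 1 := by
    apply Polynomial.coe_injective
    rw [Polynomial.coe_mul, hH, Polynomial.polynomial_map_coe, ← map_mul, ePol_mul_mk_hPoly,
      map_one, Polynomial.coe_one]
  have hdvd : (charPoly k R).map q ∣ Polynomial.X ^ (k + m) := by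
    have h1 := Polynomial.reflect_mul ((ePol k R).map q) H
      ((Polynomial.natDegree_map_le).trans natDegree_ePol_le) hHd
    rw [hEH, Polynomial.reflect_one, Polynomial.reflect_map, reflect_ePol] at h1
    exact ⟨_, h1⟩
  have hrem : ((Polynomial.X ^ α i : Polynomial (SymRing k R)) %ₘ charPoly k R).map q = 0 := by
    rw [Polynomial.map_modByMonic _ charPoly_monic, Polynomial.map_pow, Polynomial.map_X,
      Polynomial.modByMonic_eq_zero_iff_dvd (charPoly_monic.map _)]
    exact hdvd.trans (pow_dvd_pow _ hα)
  rw [genSchur, RingHom.map_det]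
  refine Matrix.det_eq_zero_of_row_eq_zero i fun l => ?_
  have := congrArg (fun p => Polynomial.coeff p (l : ℕ)) hrem
  rw [Polynomial.coeff_map, Polynomial.coeff_zero] at this
  exact this

theorem genSchur_mem_hIdeal {α : Fin k → ℕ} {i : Fin k} (hα : k + m ≤ α i) :
    genSchur R α ∈ hIdeal k m R := by
  have h : ∀ d, m < d → Ideal.Quotient.mk (hIdeal k m R) (hPoly k R d) = 0 :=
    fun d hd => Ideal.Quotient.eq_zero_iff_mem.2 (hPoly_mem_hIdeal hd)
  generalize hq : Ideal.Quotient.mk (hIdeal k m R) = q at h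
  have h1 := map_genSchur_eq_zero (B := SymRing k R ⧸ hIdeal k m R) q h hα
  rw [← hq] at h1
  exact Ideal.Quotient.eq_zero_iff_mem.1 h1

theorem exists_decomp_hPoly (f : SymRing k R) :
    ∃ v ∈ symSupp k R (expLE k m), ∃ c : Fin k → SymRing k R,
      f = v + ∑ i : Fin k, c i * hPoly k R (m + (i + 1)) := by
  suffices h : f ∈ symSupp k R (expLE k m) ⊔ (hIdeal k m R).restrictScalars R by
    obtain ⟨v, hv, w, hw, rfl⟩ := Submodule.mem_sup.1 h
    obtain ⟨c, hc⟩ := Ideal.mem_span_range_iff_exists_fun.1 hw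
    exact ⟨v, hv, c, by rw [hc]⟩
  rw [eq_sum_genSchur f]
  refine Submodule.sum_mem _ fun β _ => Submodule.smul_mem _ _ ?_
  by_cases h : ∀ i : Fin k, β i + i < k + m
  · exact Submodule.mem_sup_left (genSchur_mem_expLE h)
  · push Not at h
    obtain ⟨i, hi⟩ := h
    exact Submodule.mem_sup_right (genSchur_mem_hIdeal (α := fun i => β i + i) hi)

theorem hPoly_isHomogeneous (d : ℕ) :
    (hPoly k R d : MvPolynomial (Fin k) R).IsHomogeneous d := by
  show (hsymm (Fin k) R d).IsHomogeneous d
  rw [hsymm_eq_sum_monomial]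
  refine IsHomogeneous.sum _ _ _ fun l hl => isHomogeneous_monomial _ ?_
  rw [Finset.mem_finsuppAntidiag] at hl
  rw [Finsupp.degree_eq_sum]
  exact hl.1

end Complete

/-! ### Reduction modulo power sums -/

section PowerSums

/-- The ideal generated by `p_{m+1}, …, p_{m+k}`. -/
def pIdeal (k m : ℕ) (R : Type*) [CommRing R] : Ideal (SymRing k R) :=
  Ideal.span (Set.range fun i : Fin k => pPoly k R (m + (i + 1)))

/-- Multiply the equation `charPoly(x_i) = 0` by `x_i ^ s` and sum over `i`. -/
theorem pPoly_recurrence (s : ℕ) :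
    pPoly k R (k + s) = -∑ l ∈ Finset.range k, (charPoly k R).coeff l * pPoly k R (l + s) := by
  rcases subsingleton_or_nontrivial R with h | h
  · exact Subsingleton.elim _ _
  rw [← add_eq_zero_iff_eq_neg]
  have hlead : (charPoly k R).coeff k = 1 := by
    have := charPoly_monic (k := k) (R := R)
    rw [Polynomial.Monic, Polynomial.leadingCoeff, natDegree_charPoly] at this
    exact this
  have h1 : pPoly k R (k + s) + ∑ l ∈ Finset.range k, (charPoly k R).coeff l * pPoly k R (l + s) =
      ∑ l ∈ Finset.range (k + 1), (charPoly k R).coeff l * pPoly k R (l + s) := by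
    rw [Finset.sum_range_succ, hlead, one_mul, add_comm]
  rw [h1]
  apply symVal_injective (k := k) (R := R)
  rw [map_zero, map_sum]
  have h2 : ∀ j, symVal k R (pPoly k R j) = ∑ i : Fin k, X i ^ j := fun j => rfl
  simp only [map_mul, h2, Finset.mul_sum]
  rw [Finset.sum_comm]
  refine Finset.sum_eq_zero fun i _ => ?_
  have hroot : (charPoly k R).eval₂ (symVal k R) (X i) = 0 := by
    rw [← Polynomial.eval_map, map_charPoly, Polynomial.eval_prod]
    exact Finset.prod_eq_zero (Finset.mem_univ i) (by simp)
  rw [Polynomial.eval₂_eq_sum_range, natDegree_charPoly] at hroot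
  simp only [pow_add, ← mul_assoc]
  rw [← Finset.sum_mul, hroot, zero_mul]

theorem pPoly_mem_pIdeal {d : ℕ} (hd : m < d) : pPoly k R d ∈ pIdeal k m R := by
  induction d using Nat.strong_induction_on with
  | _ d ih =>
  by_cases hdk : d ≤ m + k
  · refine Ideal.subset_span ⟨⟨d - m - 1, by omega⟩, ?_⟩
    show pPoly k R (m + (d - m - 1 + 1)) = _
    congr 1
    omega
  · obtain ⟨s, rfl⟩ : ∃ s, d = k + s := ⟨d - k, by omega⟩
    rw [pPoly_recurrence]
    refine neg_mem (Ideal.sum_mem _ fun l hl => Ideal.mul_mem_left _ _ ?_)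
    have := Finset.mem_range.1 hl
    exact ih _ (by omega) (by omega)

/-- The sum of a polynomial over all permutations of the variables. -/
def symmetrize (k : ℕ) (R : Type*) [CommRing R] : MvPolynomial (Fin k) R →ₗ[R] SymRing k R where
  toFun f := ⟨∑ σ : Equiv.Perm (Fin k), rename σ f, fun τ => by
    rw [map_sum]
    refine Fintype.sum_equiv (Equiv.mulLeft τ) _ _ fun σ => ?_
    rw [rename_rename]
    rfl⟩
  map_add' f g := Subtype.ext (by simp [Finset.sum_add_distrib])
  map_smul' c f := Subtype.ext (by simp [Finset.smul_sum])

theorem coe_symmetrize (f : MvPolynomial (Fin k) R) :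
    (symmetrize k R f : MvPolynomial (Fin k) R) = ∑ σ : Equiv.Perm (Fin k), rename σ f := rfl

theorem symmetrize_mul (s : SymRing k R) (f : MvPolynomial (Fin k) R) :
    symmetrize k R ((s : MvPolynomial (Fin k) R) * f) = s * symmetrize k R f := by
  refine Subtype.ext ?_
  rw [coe_symmetrize]
  show _ = (s : MvPolynomial (Fin k) R) * ∑ σ : Equiv.Perm (Fin k), rename σ f
  rw [Finset.mul_sum]
  exact Finset.sum_congr rfl fun σ _ => by rw [map_mul, s.2 σ]

theorem symmetrize_rename (τ : Equiv.Perm (Fin k)) (f : MvPolynomial (Fin k) R) :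
    symmetrize k R (rename τ f) = symmetrize k R f := by
  refine Subtype.ext ?_
  rw [coe_symmetrize, coe_symmetrize]
  refine Fintype.sum_equiv (Equiv.mulRight τ) _ _ fun σ => ?_
  rw [rename_rename]
  rfl

theorem symmetrize_coe (s : SymRing k R) :
    symmetrize k R (s : MvPolynomial (Fin k) R) = k.factorial • s := by
  refine Subtype.ext ?_
  rw [coe_symmetrize, Finset.sum_congr rfl fun σ _ => s.2 σ, Finset.sum_const, Finset.card_univ,
    Fintype.card_perm, Fintype.card_fin]
  rfl

theorem symmetrize_monomial_mem_expLE {β : Fin k →₀ ℕ} (hβ : β ∈ expLE k m) :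
    symmetrize k R (monomial β 1) ∈ symSupp k R (expLE k m) := by
  intro d hd
  rw [coe_symmetrize, coeff_sum] at hd
  obtain ⟨σ, -, hσ⟩ := Finset.exists_ne_zero_of_sum_ne_zero hd
  rw [rename_monomial, coeff_monomial] at hσ
  have h : β.mapDomain σ = d := by
    by_contra h
    exact hσ (if_neg h)
  intro i
  rw [← h, Finsupp.mapDomain_equiv_apply]
  exact hβ _

theorem mem_of_nsmul_mem [Algebra ℚ R] {I : Ideal (SymRing k R)} {n : ℕ} (hn : n ≠ 0)
    {f : SymRing k R} (h : n • f ∈ I) : f ∈ I := by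
  have h1 : f = algebraMap R (SymRing k R) (algebraMap ℚ R (n : ℚ)⁻¹) * (n • f) := by
    rw [nsmul_eq_mul, ← mul_assoc]
    have h2 : (n : SymRing k R) = algebraMap R (SymRing k R) (algebraMap ℚ R (n : ℚ)) := by simp
    rw [h2, ← map_mul, ← map_mul, inv_mul_cancel₀ (Nat.cast_ne_zero.2 hn), map_one, map_one,
      one_mul]
  rw [h1]
  exact I.mul_mem_left _ h

/-- Remove `x_i` from the monomial and multiply the symmetrization of the rest by the power sum of
index `β i`. Where the power meets a variable already present, fewer variables occur and induction
applies; the other terms all equal the desired symmetrization. -/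
theorem symmetrize_monomial_mem_pIdeal [Algebra ℚ R] (β : Fin k →₀ ℕ) (i : Fin k)
    (hi : m < β i) : symmetrize k R (monomial β 1) ∈ pIdeal k m R := by
  induction hn : β.support.card using Nat.strong_induction_on generalizing β i with
  | _ n ih =>
  subst hn
  set γ := β.erase i with hγ
  have hβγ : β = γ + Finsupp.single i (β i) := (Finsupp.erase_add_single i β).symm
  have hcard : γ.support.card < β.support.card := by
    rw [hγ, Finsupp.support_erase]
    exact Finset.card_erase_lt_of_mem (Finsupp.mem_support_iff.2 (by omega))
  have hmul : pPoly k R (β i) * symmetrize k R (monomial γ 1) =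
      ∑ l, symmetrize k R (monomial (γ + Finsupp.single l (β i)) 1) := by
    rw [← symmetrize_mul, ← map_sum]
    congr 1
    show psum (Fin k) R (β i) * _ = _
    rw [psum, Finset.sum_mul]
    refine Finset.sum_congr rfl fun l _ => ?_
    rw [X_pow_eq_monomial, monomial_mul, one_mul, add_comm]
  have hmem : ∑ l, symmetrize k R (monomial (γ + Finsupp.single l (β i)) 1) ∈ pIdeal k m R := by
    rw [← hmul]
    exact Ideal.mul_mem_right _ _ (pPoly_mem_pIdeal hi)
  rw [← Finset.sum_filter_add_sum_filter_not _ (fun l => γ l = 0)] at hmem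
  have hother : ∑ l ∈ Finset.univ.filter (fun l => ¬ γ l = 0),
      symmetrize k R (monomial (γ + Finsupp.single l (β i)) 1) ∈ pIdeal k m R := by
    refine Ideal.sum_mem _ fun l hl => ?_
    have hl' : γ l ≠ 0 := (Finset.mem_filter.1 hl).2
    refine ih _ ?_ _ l (by simp; omega) rfl
    refine lt_of_le_of_lt (Finset.card_le_card ?_) hcard
    refine Finsupp.support_add.trans (Finset.union_subset subset_rfl ?_)
    refine Finsupp.support_single_subset.trans ?_
    simpa using hl'
  have hsame : ∀ l ∈ Finset.univ.filter (fun l => γ l = 0),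
      symmetrize k R (monomial (γ + Finsupp.single l (β i)) 1) =
        symmetrize k R (monomial β 1) := fun l hl => by
    have hl' : γ l = 0 := (Finset.mem_filter.1 hl).2
    rw [← symmetrize_rename (Equiv.swap l i), rename_monomial]
    conv_rhs => rw [hβγ]
    rw [Finsupp.mapDomain_add, Finsupp.mapDomain_single, Equiv.swap_apply_left]
    refine congrArg (fun δ => symmetrize k R (monomial (δ + Finsupp.single i (β i)) 1)) (Finsupp.ext fun x => ?_)
    rw [Finsupp.mapDomain_equiv_apply, Equiv.symm_swap]
    have hγi : γ i = 0 := Finsupp.erase_same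
    by_cases hxl : x = l
    · rw [hxl, Equiv.swap_apply_left, hγi, hl']
    by_cases hxi : x = i
    · rw [hxi, Equiv.swap_apply_right, hγi, hl']
    · rw [Equiv.swap_apply_of_ne_of_ne hxl hxi]
  have h := (Ideal.add_mem_iff_left _ hother).1 hmem
  rw [Finset.sum_congr rfl hsame, Finset.sum_const] at h
  -- The multiplicity is the number of variables absent from the remaining monomial; `x_i` is one of
  -- them, so it is nonzero and invertible in `R`.
  refine mem_of_nsmul_mem (Finset.card_ne_zero_of_mem (a := i) ?_) h
  simp [hγ]

theorem exists_decomp_pPoly [Algebra ℚ R] (f : SymRing k R) :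
    ∃ v ∈ symSupp k R (expLE k m), ∃ c : Fin k → SymRing k R,
      f = v + ∑ i : Fin k, c i * pPoly k R (m + (i + 1)) := by
  -- Symmetrizing `f` multiplies it by `k!`, which is invertible, so the question reduces to
  -- symmetrized monomials.
  suffices h : k.factorial • f ∈ symSupp k R (expLE k m) ⊔ (pIdeal k m R).restrictScalars R by
    have h1 : f = algebraMap ℚ R (k.factorial : ℚ)⁻¹ • (k.factorial • f) := by
      rw [← Nat.cast_smul_eq_nsmul R, smul_smul, ← map_natCast (algebraMap ℚ R), ← map_mul,
        inv_mul_cancel₀ (Nat.cast_ne_zero.2 (Nat.factorial_ne_zero k)), map_one, one_smul]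
    have h2 := Submodule.smul_mem _ (algebraMap ℚ R (k.factorial : ℚ)⁻¹) h
    rw [← h1] at h2
    obtain ⟨v, hv, w, hw, rfl⟩ := Submodule.mem_sup.1 h2
    obtain ⟨c, hc⟩ := Ideal.mem_span_range_iff_exists_fun.1 hw
    exact ⟨v, hv, c, by rw [hc]⟩
  rw [← symmetrize_coe, (f : MvPolynomial (Fin k) R).as_sum, map_sum]
  refine Submodule.sum_mem _ fun β _ => ?_
  rw [← mul_one (coeff β (f : MvPolynomial (Fin k) R)), ← smul_eq_mul, ← smul_monomial, map_smul]
  refine Submodule.smul_mem _ _ ?_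
  by_cases h : β ∈ expLE k m
  · exact Submodule.mem_sup_left (symmetrize_monomial_mem_expLE h)
  · simp only [expLE, Set.mem_ofPred_eq] at h
    push Not at h
    obtain ⟨i, hi⟩ := h
    exact Submodule.mem_sup_right (symmetrize_monomial_mem_pIdeal β i hi)

theorem pPoly_isHomogeneous (d : ℕ) :
    (pPoly k R d : MvPolynomial (Fin k) R).IsHomogeneous d :=
  IsHomogeneous.sum _ _ _ fun i _ => isHomogeneous_X_pow i d

end PowerSums

/-- A sequence of homogeneous symmetric polynomials that generate, together with the polynomials
with exponents at most `m`, gives rise to the three bases. -/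
theorem isBasisMod_families {g a : Fin k → SymRing k R}
    (hg : ∀ i, (g i : MvPolynomial (Fin k) R).IsHomogeneous (m + (i + 1)))
    (ha : ∀ i : Fin k, (a i : MvPolynomial (Fin k) R).totalDegree < m + (i + 1))
    (hK : ∀ f : SymRing k R, ∃ v ∈ symSupp k R (expLE k m), ∃ c : Fin k → SymRing k R,
      f = v + ∑ i, c i * g i) :
    IsBasisMod (Ideal.span (Set.range fun i => g i - a i))
        (fun μ : Box k m => sPoly k R μ.1) ∧
      IsBasisMod (Ideal.span (Set.range fun i => g i - a i))
        (fun μ : Box k m => mPoly k R μ.1) ∧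
      IsBasisMod (Ideal.span (Set.range fun i => g i - a i))
        (fun μ : Box k m => ePoly k R μ.1.transpose) := by
  have h := isBasisMod_eMon hg (fun i => mem_symSupp_degLT.2 (Nat.le_of_lt_succ (ha i))) hK
  exact ⟨isBasisMod_of_span h expLE_le_span_sPoly, isBasisMod_of_span h expLE_le_span_mPoly,
    isBasisMod_ePoly h⟩

end Generation

end SymBases

end

theorem corollary1p2 {k n : ℕ} (hk : 0 < k) (hkn : k ≤ n) {R : Type*} [CommRing R]
    (a : Fin k → SymBases.SymRing k R)
    (ha : ∀ i : Fin k,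
      (a i : MvPolynomial (Fin k) R).totalDegree < n - k + ((i : ℕ) + 1)) :
    (∀ [Algebra ℚ R],
      SymBases.IsBasisMod (SymBases.idealP n a)
        (fun μ : SymBases.Box k (n - k) => SymBases.sPoly k R μ.1) ∧
      SymBases.IsBasisMod (SymBases.idealP n a)
        (fun μ : SymBases.Box k (n - k) => SymBases.mPoly k R μ.1) ∧
      SymBases.IsBasisMod (SymBases.idealP n a)
        (fun μ : SymBases.Box k (n - k) => SymBases.ePoly k R μ.1.transpose)) ∧
    (SymBases.IsBasisMod (SymBases.idealH n a)
        (fun μ : SymBases.Box k (n - k) => SymBases.sPoly k R μ.1) ∧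
      SymBases.IsBasisMod (SymBases.idealH n a)
        (fun μ : SymBases.Box k (n - k) => SymBases.mPoly k R μ.1) ∧
      SymBases.IsBasisMod (SymBases.idealH n a)
        (fun μ : SymBases.Box k (n - k) => SymBases.ePoly k R μ.1.transpose)) := by
  exact ⟨fun {_} => SymBases.isBasisMod_families (fun i => SymBases.pPoly_isHomogeneous _) ha
      SymBases.exists_decomp_pPoly,
    SymBases.isBasisMod_families (fun i => SymBases.hPoly_isHomogeneous _) ha
      SymBases.exists_decomp_hPoly⟩
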